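/- Let $\mathbb{K}$ be $\mathbb{R}$ or $\mathbb{C}$ and let $V = V_{\mathbf 0} \oplus V_{\mathbf 1}$ be a $\mathbb{Z}_2$-graded Hausdorff locally convex $\mathbb{K}$-vector space whose projections onto the even and odd part are continuous. *Symmetric algebra.* Let $S_n$ act on $V^{\otimes n}$ from the right by $(v_1 \otimes \cdots \otimes v_n) \triangleleft \sigma = \pm\, v_{\sigma(1)} \otimes \cdots \otimes v_{\sigma(n)}$ for homogeneous $v_k$, with the Koszul sign (a factor $-1$ for each inversion of $\sigma$ between two odd vectors). Let $\mathcal{S}_n = \frac{1}{n!} \sum_{\sigma \in S_n} (\,\cdot\,) \triangleleft \sigma$, let $\mathcal{S} = \bigoplus_n \mathcal{S}_n$ on the tensor algebra $\mathrm{T}^\bullet(V) = \bigoplus_{n \ge 0} V^{\otimes n}$, and let $\mathrm{Sym}^\bullet(V) = \operatorname{im} \mathcal{S}$. For $v_1, \ldots, v_n \in V$ and linear functionals $\varphi^1, \ldots, \varphi^n$ on $V$ write $v_1 \cdots v_n = \mathcal{S}(v_1 \otimes \cdots \otimes v_n) \in \mathrm{Sym}^\bullet(V)$ (which is $1$ for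 $n = 0$) and $\varphi^1 \cdots \varphi^n = (\varphi^1 \otimes \cdots \otimes \varphi^n) \circ \mathcal{S}$, where $(\varphi^1 \otimes \cdots \otimes \varphi^n)(v_1 \otimes \cdots \otimes v_n) = \varphi^1(v_1) \cdots \varphi^n(v_n)$, extended by zero to the other tensor degrees. *Topologies.* For a seminorm $p$ on $V$ let $p^n = p \otimes \cdots \otimes p$ be the projective tensor power on $V^{\otimes n}$, with $p^0 = |\cdot|$, and for $R \in \mathbb{R}$ let $p_R(v) = \sum_{n=0}^\infty p^n(v_n)\, n!^R$, where $v_n$ is the component of $v$ in $V^{\otimes n}$. Then $\mathrm{Sym}^\bullet_R(V)$ is $\mathrm{Sym}^\bullet(V)$ with the subspace topology of $\mathrm{T}^\bullet(V)$ topologized by all $p_R$, where $p$ runs through the continuous seminorms on $V$, and $\mathcal{W}_{R^-}(V) = \varprojlim_{\epsilon \to 0} \mathrm{Sym}^\bullet_{R-\epsilon}(V)$ is the same vector space with the topology of all $p_{R-\epsilon}$, $\epsilon > 0$. *Bases.* An absolute Schauder basis of a topological vector space $E$ is a linearly independent family $\{e_i\}_{i \in I}$ in $E$ with continuous linear functionals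 $\{\varphi^i\}_{i \in I}$ (the coefficient functionals) such that $\varphi^i(e_j) = \delta^i_j$, such that $v = \sum_{i \in I} \varphi^i(v) e_i$ converges (as the net of finite partial sums) for all $v \in E$, and such that for every continuous seminorm $p$ on $E$ there is a continuous seminorm $q$ on $E$ with $$\sum_{i \in I} |\varphi^i(v)|\, p(e_i) \le q(v) \quad \text{for all } v \in E. \tag{1}$$ **Proposition.** Let $R \ge 0$ and let $\{e_i\}_{i \in I}$ be an absolute Schauder basis of $V$ of homogeneous vectors with coefficient functionals $\{\varphi^i\}_{i \in I}$. Then every maximal linearly independent subset $B$ of $\{e_{i_1} \cdots e_{i_n} \mid n \in \mathbb{N}_0,\ i_1, \ldots, i_n \in I\}$ is an absolute Schauder basis of $\mathrm{Sym}^\bullet_R(V)$ and of $\mathcal{W}_{R^-}(V)$. The coefficient functional of an element $b = e_{i_1} \cdots e_{i_n}$ of $B$ is in both cases $$\psi_b = \frac{n!}{\prod_{i \in I} m_i!}\ \varphi^{i_1} \cdots \varphi^{i_n},$$ where $m_i$ is the number of occurrences of $i$ in $(i_1, \ldots, i_n)$. Moreover, if $p$ and $q$ are continuous seminorms on $V$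 satisfying (1) for the given basis of $V$, then for all $S \le R$ and all $v \in \mathrm{Sym}^\bullet(V)$ $$\sum_{n=0}^\infty \sum_{i_1, \ldots, i_n \in I} \left|(\varphi^{i_1} \cdots \varphi^{i_n})(v)\right|\, p_S(e_{i_1} \cdots e_{i_n}) \le q_S(v) \quad\text{and}\quad \sum_{b \in B} |\psi_b(v)|\, p_S(b) \le q_S(v).$$ -/

import Mathlib

open scoped TensorProduct DirectSum

noncomputable section

/-! ### Absolute Schauder bases -/

/-- The estimate `∑ i, |φ i v| * p (e i) ≤ q v` for all `v`, including convergence of the series. -/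
def AbsEstimate {𝕜 E ι : Type*} [RCLike 𝕜] [AddCommGroup E] [Module 𝕜 E]
    (e : ι → E) (φ : ι → E →ₗ[𝕜] 𝕜) (p q : Seminorm 𝕜 E) : Prop :=
  ∀ v : E, Summable (fun i => ‖φ i v‖ * p (e i)) ∧ ∑' i, ‖φ i v‖ * p (e i) ≤ q v

/-- The family `e` is an absolute Schauder basis of the topological vector space `E`, with the
family `φ` of coefficient functionals. -/
structure IsAbsoluteSchauderBasis (𝕜 : Type*) {E ι : Type*} [RCLike 𝕜] [AddCommGroup E]
    [Module 𝕜 E] [τ : TopologicalSpace E] (e : ι → E) (φ : ι → E →ₗ[𝕜] 𝕜) : Prop where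
  linearIndependent : LinearIndependent 𝕜 e
  continuous_coeff : ∀ i, Continuous (φ i)
  coeff_self : ∀ i, φ i (e i) = 1
  coeff_of_ne : ∀ i j, i ≠ j → φ i (e j) = 0
  expansion : ∀ v : E, HasSum (fun i => φ i v • e i) v
  absolute : ∀ p : Seminorm 𝕜 E, Continuous p →
    ∃ q : Seminorm 𝕜 E, Continuous q ∧ AbsEstimate e φ p q

/-! ### Seminorms on tensor powers and on the tensor algebra -/

section Seminorms

variable {𝕜 V : Type*} [RCLike 𝕜] [AddCommGroup V] [Module 𝕜 V]

/-- The cost `∑ |c| * p (v 1) * ⋯ * p (v n)` of a formal sum of scaled elementary tensors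
`c • v 1 ⊗ ⋯ ⊗ v n`. -/
def tensorCost (p : Seminorm 𝕜 V) {n : ℕ} (l : FreeAddMonoid (𝕜 × (Fin n → V))) : ℝ :=
  (l.toList.map (fun x => ‖x.1‖ * ∏ k, p (x.2 k))).sum

theorem tensorCost_nonneg (p : Seminorm 𝕜 V) {n : ℕ} (l : FreeAddMonoid (𝕜 × (Fin n → V))) :
    0 ≤ tensorCost p l := by
  refine List.sum_nonneg fun a ha => ?_
  obtain ⟨x, -, rfl⟩ := List.mem_map.1 ha
  exact mul_nonneg (norm_nonneg _) (Finset.prod_nonneg fun k _ => apply_nonneg p _)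

theorem bddBelow_tensorCost (p : Seminorm 𝕜 V) {n : ℕ} (v : ⨂[𝕜]^n V) :
    BddBelow (Set.range (fun l : PiTensorProduct.lifts v => tensorCost p l.1)) :=
  ⟨0, by rintro _ ⟨l, rfl⟩; exact tensorCost_nonneg p _⟩

/-- The projective seminorm `pⁿ = p ⊗ ⋯ ⊗ p` on the `n`-th tensor power: the infimum of
`∑ |c| * p (v 1) * ⋯ * p (v n)` over all ways to write the given tensor as a finite sum of terms
`c • v 1 ⊗ ⋯ ⊗ v n`. For `n = 0` this is the absolute value of the scalar. -/
def tensorPowSeminorm (p : Seminorm 𝕜 V) (n : ℕ) : Seminorm 𝕜 (⨂[𝕜]^n V) :=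
  Seminorm.ofSMulLE (fun v => ⨅ l : PiTensorProduct.lifts v, tensorCost p l.1)
    (le_antisymm
      (ciInf_le_of_le (bddBelow_tensorCost p _) ⟨0, PiTensorProduct.lifts_zero⟩
        (by simp [tensorCost]))
      (le_ciInf fun l => tensorCost_nonneg p l.1))
    (fun v w => le_ciInf_add_ciInf fun l m =>
      ciInf_le_of_le (bddBelow_tensorCost p _) ⟨l.1 + m.1, PiTensorProduct.lifts_add l.2 m.2⟩
        (by simp [tensorCost]))
    (fun c v => by
      rw [Real.mul_iInf_of_nonneg (norm_nonneg _)]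
      refine le_ciInf fun l => ?_
      refine ciInf_le_of_le (bddBelow_tensorCost p _) ⟨_, PiTensorProduct.lifts_smul l.2 c⟩ ?_
      simp [tensorCost, Function.comp_def, mul_assoc, List.sum_map_mul_left])

/-- The tensor algebra as a vector space: the direct sum of all tensor powers. -/
abbrev TensorAlg (𝕜 V : Type*) [RCLike 𝕜] [AddCommGroup V] [Module 𝕜 V] : Type _ :=
  ⨁ n : ℕ, ⨂[𝕜]^n V

theorem summable_weighted (p : Seminorm 𝕜 V) (R : ℝ) (v : TensorAlg 𝕜 V) :
    Summable fun n => tensorPowSeminorm p n (v n) * (n.factorial : ℝ) ^ R := by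
  classical
  refine summable_of_ne_finset_zero (s := DFinsupp.support v) fun n hn => ?_
  have h : v n = 0 := DFinsupp.notMem_support_iff.1 hn
  rw [h, map_zero, zero_mul]

/-- The seminorm `p_R (v) = ∑ n, pⁿ (v n) * (n!) ^ R` on the tensor algebra. -/
def weightedSeminorm (p : Seminorm 𝕜 V) (R : ℝ) : Seminorm 𝕜 (TensorAlg 𝕜 V) :=
  Seminorm.of (fun v => ∑' n, tensorPowSeminorm p n (v n) * (n.factorial : ℝ) ^ R)
    (fun v w => by
      rw [← (summable_weighted p R v).tsum_add (summable_weighted p R w)]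
      refine (summable_weighted p R (v + w)).tsum_le_tsum (fun n => ?_)
        ((summable_weighted p R v).add (summable_weighted p R w))
      rw [← add_mul, DirectSum.add_apply]
      exact mul_le_mul_of_nonneg_right (map_add_le_add _ _ _)
        (Real.rpow_nonneg (Nat.cast_nonneg _) _))
    (fun c v => by
      rw [← tsum_mul_left]
      refine tsum_congr fun n => ?_
      rw [DirectSum.smul_apply, map_smul_eq_mul, mul_assoc])

end Seminorms

/-! ### The graded symmetrizer and the symmetric algebra -/

section Symmetric

variable {𝕜 V : Type*} [RCLike 𝕜] [AddCommGroup V] [Module 𝕜 V]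
variable (𝒱 : ZMod 2 → Submodule 𝕜 V) [DirectSum.Decomposition 𝒱]

/-- The projection of `V` onto its homogeneous part of parity `a`. -/
def parityProj (a : ZMod 2) : V →ₗ[𝕜] V :=
  (𝒱 a).subtype ∘ₗ DirectSum.component 𝕜 (ZMod 2) (fun b => 𝒱 b) a ∘ₗ
    (DirectSum.decomposeLinearEquiv 𝒱).toLinearMap

/-- The Koszul sign of the reordering of `n` factors of parities `ε 1, …, ε n` into the order
`σ 1, …, σ n`: a factor `-1` for each inversion of `σ` between two odd factors. -/
def koszulSign {n : ℕ} (ε : Fin n → ZMod 2) (σ : Equiv.Perm (Fin n)) : ℤ :=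
  ∏ i : Fin n, ∏ j : Fin n,
    if i < j ∧ σ j < σ i ∧ ε (σ i) = 1 ∧ ε (σ j) = 1 then -1 else 1

/-- The graded right action of a permutation on the `n`-th tensor power: the linear map that sends
`v 1 ⊗ ⋯ ⊗ v n`, for homogeneous vectors of parities `ε 1, …, ε n`, to
`koszulSign ε σ • v (σ 1) ⊗ ⋯ ⊗ v (σ n)`. -/
def gradedPerm {n : ℕ} (σ : Equiv.Perm (Fin n)) : ⨂[𝕜]^n V →ₗ[𝕜] ⨂[𝕜]^n V :=
  ∑ ε : Fin n → ZMod 2, (koszulSign ε σ : 𝕜) •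
    ((PiTensorProduct.reindex 𝕜 (fun _ : Fin n => V) σ.symm).toLinearMap ∘ₗ
      PiTensorProduct.map (fun k => parityProj 𝒱 (ε k)))

/-- The symmetrizer on the `n`-th tensor power. -/
def symmetrizerPow (n : ℕ) : ⨂[𝕜]^n V →ₗ[𝕜] ⨂[𝕜]^n V :=
  (n.factorial : 𝕜)⁻¹ • ∑ σ : Equiv.Perm (Fin n), gradedPerm 𝒱 σ

/-- The symmetrizer on the tensor algebra. -/
def symmetrizer : TensorAlg 𝕜 V →ₗ[𝕜] TensorAlg 𝕜 V :=
  DirectSum.lmap (fun n => symmetrizerPow 𝒱 n)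

/-- The symmetric algebra of the `ℤ/2`-graded vector space, as the image of the symmetrizer. -/
def GradedSym : Submodule 𝕜 (TensorAlg 𝕜 V) := LinearMap.range (symmetrizer 𝒱)

/-- The symmetrized product `v 1 ⋯ v n` in the symmetric algebra, that is, the symmetrization of
`v 1 ⊗ ⋯ ⊗ v n`. -/
def symProd {n : ℕ} (v : Fin n → V) : GradedSym 𝒱 :=
  ⟨symmetrizer 𝒱 (DirectSum.lof 𝕜 ℕ (fun n => ⨂[𝕜]^n V) n (PiTensorProduct.tprod 𝕜 v)),
    LinearMap.mem_range_self _ _⟩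

/-- The functional `φ 1 ⊗ ⋯ ⊗ φ n` on the `n`-th tensor power, which sends `v 1 ⊗ ⋯ ⊗ v n` to
`φ 1 (v 1) * ⋯ * φ n (v n)`, extended by zero to the other tensor degrees. -/
def tensorFunctional {n : ℕ} (φ : Fin n → V →ₗ[𝕜] 𝕜) : TensorAlg 𝕜 V →ₗ[𝕜] 𝕜 :=
  PiTensorProduct.lift ((MultilinearMap.mkPiAlgebra 𝕜 (Fin n) 𝕜).compLinearMap φ) ∘ₗ
    DirectSum.component 𝕜 ℕ (fun n => ⨂[𝕜]^n V) n

/-- The symmetrized functional `φ 1 ⋯ φ n = (φ 1 ⊗ ⋯ ⊗ φ n) ∘ symmetrizer` on the symmetric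
algebra. -/
def symFunctional {n : ℕ} (φ : Fin n → V →ₗ[𝕜] 𝕜) : GradedSym 𝒱 →ₗ[𝕜] 𝕜 :=
  tensorFunctional φ ∘ₗ symmetrizer 𝒱 ∘ₗ (GradedSym 𝒱).subtype

/-- The restriction of `p_R` to the symmetric algebra. -/
def symSeminorm (p : Seminorm 𝕜 V) (R : ℝ) : Seminorm 𝕜 (GradedSym 𝒱) :=
  (weightedSeminorm p R).comp (GradedSym 𝒱).subtype

end Symmetric

/-- The number of distinct rearrangements of a tuple `(t 1, …, t n)`, that is, the multinomial
coefficient `n! / ∏ mᵢ!` where `mᵢ` is the multiplicity of `i` in `t`. -/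
def rearrangements {I : Type*} {n : ℕ} (t : Fin n → I) : ℕ :=
  Nat.card {s : Fin n → I // ∃ σ : Equiv.Perm (Fin n), s = t ∘ σ}

/-! ### The topologies -/

section Topologies

variable {𝕜 V : Type*} [RCLike 𝕜] [AddCommGroup V] [Module 𝕜 V] [TopologicalSpace V]

instance nonempty_continuousSeminorm : Nonempty {p : Seminorm 𝕜 V // Continuous p} :=
  ⟨⟨0, continuous_const⟩⟩

/-- The locally convex topology of `T_R(V)`: the one defined by all the seminorms `p_R`, where `p`
is a continuous seminorm on `V`. -/
abbrev tensorTopology (𝕜 V : Type*) [RCLike 𝕜] [AddCommGroup V] [Module 𝕜 V] [TopologicalSpace V]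
    (R : ℝ) : TopologicalSpace (TensorAlg 𝕜 V) :=
  SeminormFamily.moduleFilterBasis (𝕜 := 𝕜) (F := TensorAlg 𝕜 V)
    (fun p : {p : Seminorm 𝕜 V // Continuous p} => weightedSeminorm p.1 R) |>.topology

variable (𝒱 : ZMod 2 → Submodule 𝕜 V) [DirectSum.Decomposition 𝒱]

/-- The topology of `Sym_R(V)`: the subspace topology of `T_R(V)`. -/
abbrev symTopology (R : ℝ) : TopologicalSpace (GradedSym 𝒱) :=
  (tensorTopology 𝕜 V R).induced (GradedSym 𝒱).subtype

/-- The topology of `W_{R^-}(V)`: the underlying vector space is the symmetric algebra, and the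
topology is that of the projective limit of `Sym_{R - ε}(V)` for `ε → 0` along the identity maps,
i.e. the coarsest topology finer than the topologies of all `Sym_{R - ε}(V)`, `ε > 0`. -/
abbrev weylMinusTopology (R : ℝ) : TopologicalSpace (GradedSym 𝒱) :=
  ⨅ ε : {ε : ℝ // 0 < ε}, symTopology 𝒱 (R - ε.1)

end Topologies

end

noncomputable section

/-! ### Approximation with respect to a single seminorm -/

section Approximation

variable {𝕜 E F : Type*} [RCLike 𝕜] [AddCommGroup E] [Module 𝕜 E] [AddCommGroup F] [Module 𝕜 F]

/-! The algebraic heart is the pairing of the functionals `φ (t 1) ⋯ φ (t n)` with the products of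
the `e i`. It vanishes unless one tuple rearranges the other. On a nonzero product only the
permutations fixing `t` contribute, all with sign `1`, since a sign `-1` would make the product
equal to its negative. By orbit-stabilizer the value is the inverse of `rearrangements t`
(`rearrangements_mul_symFunctional_symProd`), which explains the multinomial factor.

The estimates rest on the maximality of the projective seminorm (`le_tensorPowSeminorm`): a bound
need only be checked on elementary tensors, where a sum over tuples factors into sums over single
indices (`AbsEstimate.sum_tensorPow_le`). Symmetrizing costs nothing: the symmetrizer fixes
`GradedSym 𝒱`, and it does not increase the bound for products of homogeneous vectors. The weights
are constant in each degree, so every exponent is treated alike. The sum over `B` is then a subsum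
of the sum over all tuples, grouped by rearrangements
(`IsAbsoluteSchauderBasis.absEstimate_of_linearIndepOn`).

Convergence follows without completeness: the absolute estimate makes the partial sums
equicontinuous, and they stabilize on the span, which is dense
(`IsAbsoluteSchauderBasis.of_withSeminorms`). Density is also what makes the coefficient functionals
independent of the order of factors: the two candidates are continuous and agree on products
(`IsAbsoluteSchauderBasis.symFunctional_comp_perm`). -/

/-- The closure of a submodule with respect to a seminorm. -/
def Seminorm.closureSubmodule (r : Seminorm 𝕜 E) (N : Submodule 𝕜 E) : Submodule 𝕜 E where
  carrier := {x | ∀ ε > 0, ∃ w ∈ N, r (x - w) < ε}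
  zero_mem' := fun ε hε => ⟨0, N.zero_mem, by simpa using hε⟩
  add_mem' := by
    intro x y hx hy ε hε
    obtain ⟨w, hw, hxw⟩ := hx (ε / 2) (half_pos hε)
    obtain ⟨z, hz, hyz⟩ := hy (ε / 2) (half_pos hε)
    refine ⟨w + z, N.add_mem hw hz, ?_⟩
    rw [add_sub_add_comm]
    linarith [map_add_le_add r (x - w) (y - z)]
  smul_mem' := by
    intro c x hx ε hε
    obtain ⟨w, hw, hxw⟩ := hx (ε / (‖c‖ + 1)) (by positivity)
    refine ⟨c • w, N.smul_mem c hw, ?_⟩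
    rw [← smul_sub, map_smul_eq_mul]
    rw [lt_div_iff₀ (by positivity)] at hxw
    nlinarith [apply_nonneg r (x - w)]

theorem Seminorm.le_closureSubmodule (r : Seminorm 𝕜 E) (N : Submodule 𝕜 E) :
    N ≤ r.closureSubmodule N := fun x hx ε hε => ⟨x, hx, by simpa using hε⟩

theorem Seminorm.mem_closureSubmodule_of_forall {r : Seminorm 𝕜 E} {N : Submodule 𝕜 E} {x : E}
    (h : ∀ ε > 0, ∃ w ∈ r.closureSubmodule N, r (x - w) < ε) : x ∈ r.closureSubmodule N := by
  intro ε hε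
  obtain ⟨w, hw, hxw⟩ := h (ε / 2) (half_pos hε)
  obtain ⟨z, hz, hwz⟩ := hw (ε / 2) (half_pos hε)
  refine ⟨z, hz, ?_⟩
  rw [← sub_add_sub_cancel x w z]
  linarith [map_add_le_add r (x - w) (w - z)]

theorem Seminorm.map_mem_closureSubmodule {r : Seminorm 𝕜 F} (T : E →ₗ[𝕜] F)
    {N : Submodule 𝕜 E} {x : E} (hx : x ∈ (r.comp T).closureSubmodule N) :
    T x ∈ r.closureSubmodule (N.map T) := by
  intro ε hε
  obtain ⟨w, hw, hxw⟩ := hx ε hε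
  exact ⟨T w, Submodule.mem_map_of_mem hw, by rwa [← map_sub]⟩

/-- A linear map that is bounded by a seminorm vanishes on the closure of its kernel. -/
theorem LinearMap.eq_zero_of_mem_closureSubmodule {r : Seminorm 𝕜 E} {f : E →ₗ[𝕜] 𝕜} {C : ℝ}
    (hf : ∀ x, ‖f x‖ ≤ C * r x) {N : Submodule 𝕜 E} (hN : N ≤ LinearMap.ker f) {x : E}
    (hx : x ∈ r.closureSubmodule N) : f x = 0 := by
  by_contra h
  have h0 : 0 < ‖f x‖ := norm_pos_iff.2 h
  obtain ⟨w, hw, hxw⟩ := hx (‖f x‖ / (|C| + 1)) (by positivity)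
  have h1 := hf (x - w)
  rw [map_sub, LinearMap.mem_ker.1 (hN hw), sub_zero] at h1
  rw [lt_div_iff₀ (by positivity)] at hxw
  nlinarith [apply_nonneg r (x - w), le_abs_self C]

end Approximation

/-! ### Projective seminorms -/

section TensorPowSeminorm

variable {𝕜 V : Type*} [RCLike 𝕜] [AddCommGroup V] [Module 𝕜 V]

theorem tensorPowSeminorm_tprod_le (p : Seminorm 𝕜 V) {n : ℕ} (v : Fin n → V) :
    tensorPowSeminorm p n (PiTensorProduct.tprod 𝕜 v) ≤ ∏ k, p (v k) :=
  ciInf_le_of_le (bddBelow_tensorCost p _)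
    ⟨FreeAddMonoid.of (1, v), by
      simp [PiTensorProduct.mem_lifts_iff]⟩ (by simp [tensorCost])

/-- The projective seminorm is the largest seminorm `r` with `r (v 1 ⊗ ⋯ ⊗ v n) ≤ ∏ k, p (v k)`. -/
theorem le_tensorPowSeminorm {p : Seminorm 𝕜 V} {n : ℕ} {r : Seminorm 𝕜 (⨂[𝕜]^n V)}
    (h : ∀ v : Fin n → V, r (PiTensorProduct.tprod 𝕜 v) ≤ ∏ k, p (v k)) :
    r ≤ tensorPowSeminorm p n := by
  intro x
  have : Nonempty (PiTensorProduct.lifts x) := (PiTensorProduct.nonempty_lifts x).to_subtype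
  refine le_ciInf ?_
  rintro ⟨l, hl⟩
  rw [PiTensorProduct.mem_lifts_iff] at hl
  subst hl
  simp only [tensorCost]
  induction l.toList with
  | nil => simp
  | cons a l ih =>
    simp only [List.map_cons, List.sum_cons]
    refine (map_add_le_add _ _ _).trans (add_le_add ?_ ih)
    rw [map_smul_eq_mul]
    exact mul_le_mul_of_nonneg_left (h _) (norm_nonneg _)

theorem tensorPowSeminorm_mono {p q : Seminorm 𝕜 V} (h : p ≤ q) (n : ℕ) :
    tensorPowSeminorm p n ≤ tensorPowSeminorm q n :=
  le_tensorPowSeminorm fun v => (tensorPowSeminorm_tprod_le p v).trans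
    (Finset.prod_le_prod (fun _ _ => apply_nonneg _ _) fun k _ => h (v k))

theorem weightedSeminorm_apply (p : Seminorm 𝕜 V) (R : ℝ) (v : TensorAlg 𝕜 V) :
    weightedSeminorm p R v = ∑' n, tensorPowSeminorm p n (v n) * (n.factorial : ℝ) ^ R := rfl

theorem weightedSeminorm_mono {p q : Seminorm 𝕜 V} (h : p ≤ q) (R : ℝ) :
    weightedSeminorm p R ≤ weightedSeminorm q R := fun v =>
  (summable_weighted p R v).tsum_le_tsum (fun n => mul_le_mul_of_nonneg_right
    (tensorPowSeminorm_mono h n (v n)) (by positivity)) (summable_weighted q R v)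

theorem tensorPowSeminorm_mul_le_weightedSeminorm (p : Seminorm 𝕜 V) (R : ℝ) (v : TensorAlg 𝕜 V)
    (n : ℕ) :
    tensorPowSeminorm p n (v n) * (n.factorial : ℝ) ^ R ≤ weightedSeminorm p R v :=
  (summable_weighted p R v).le_tsum n fun m _ => mul_nonneg (apply_nonneg _ _) (by positivity)

theorem weightedSeminorm_lof (p : Seminorm 𝕜 V) (R : ℝ) (n : ℕ) (x : ⨂[𝕜]^n V) :
    weightedSeminorm p R (DirectSum.lof 𝕜 ℕ (fun n => ⨂[𝕜]^n V) n x) =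
      tensorPowSeminorm p n x * (n.factorial : ℝ) ^ R := by
  rw [weightedSeminorm_apply, tsum_eq_single n]
  · rw [DirectSum.lof_apply]
  · intro m hm
    rw [DirectSum.lof_eq_of, DirectSum.of_eq_of_ne _ _ _ hm, map_zero, zero_mul]

/-- If `e` spans a dense subspace then so do the elementary tensors with entries from `e`. -/
theorem mem_closureSubmodule_tprod {I : Type*} {e : I → V} {p : Seminorm 𝕜 V}
    (he : ∀ v, v ∈ p.closureSubmodule (Submodule.span 𝕜 (Set.range e)))
    {n : ℕ} {r : Seminorm 𝕜 (⨂[𝕜]^n V)} {C : ℝ}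
    (h : ∀ v : Fin n → V, r (PiTensorProduct.tprod 𝕜 v) ≤ C * ∏ k, p (v k))
    (x : ⨂[𝕜]^n V) :
    x ∈ r.closureSubmodule
      (Submodule.span 𝕜 (Set.range fun t : Fin n → I => PiTensorProduct.tprod 𝕜 fun k => e (t k))) := by
  classical
  set D := r.closureSubmodule
    (Submodule.span 𝕜 (Set.range fun t : Fin n → I => PiTensorProduct.tprod 𝕜 fun k => e (t k)))
  -- `A` is the set of slots that may hold arbitrary vectors; the induction frees one slot at a
  -- time.
  have key : ∀ A : Finset (Fin n), ∀ v : Fin n → V, (∀ k ∉ A, v k ∈ Set.range e) →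
      PiTensorProduct.tprod 𝕜 v ∈ D := by
    intro A
    induction A using Finset.induction with
    | empty =>
      intro v hv
      choose t ht using fun k => hv k (Finset.notMem_empty k)
      exact r.le_closureSubmodule _ (Submodule.subset_span ⟨t, by simp only [ht]⟩)
    | insert a A ha ih =>
      intro v hv
      have hspan : ∀ w ∈ Submodule.span 𝕜 (Set.range e),
          PiTensorProduct.tprod 𝕜 (Function.update v a w) ∈ D := by
        intro w hw
        have : Submodule.span 𝕜 (Set.range e) ≤
            D.comap ((PiTensorProduct.tprod 𝕜).toLinearMap v a) := by
          refine Submodule.span_le.2 ?_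
          rintro _ ⟨i, rfl⟩
          refine ih _ fun k hk => ?_
          rcases eq_or_ne k a with rfl | hka
          · simp
          · rw [Function.update_of_ne hka]
            exact hv k (by simp [hka, hk])
        exact this hw
      refine Seminorm.mem_closureSubmodule_of_forall fun ε hε => ?_
      -- `P` bounds the effect on `r` of changing slot `a`, per unit of `p`; `P + 1` avoids division
      -- by zero.
      set P := |C| * ∏ k ∈ Finset.univ.erase a, p (v k) with hP
      have hP0 : 0 ≤ P := mul_nonneg (abs_nonneg _) (Finset.prod_nonneg fun _ _ => apply_nonneg _ _)
      obtain ⟨w, hw, hvw⟩ := he (v a) (ε / (P + 1)) (by positivity)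
      refine ⟨_, hspan w hw, ?_⟩
      have h1 : PiTensorProduct.tprod 𝕜 v - PiTensorProduct.tprod 𝕜 (Function.update v a w) =
          PiTensorProduct.tprod 𝕜 (Function.update v a (v a - w)) := by
        rw [MultilinearMap.map_update_sub, Function.update_eq_self]
      have h2 : ∏ k, p (Function.update v a (v a - w) k) =
          p (v a - w) * ∏ k ∈ Finset.univ.erase a, p (v k) := by
        rw [← Finset.mul_prod_erase _ _ (Finset.mem_univ a), Function.update_self]
        congr 1
        refine Finset.prod_congr rfl fun k hk => ?_
        rw [Function.update_of_ne (Finset.ne_of_mem_erase hk)]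
      rw [h1]
      refine (h _).trans_lt ?_
      rw [h2]
      rw [lt_div_iff₀ (by positivity)] at hvw
      have h3 : C * (p (v a - w) * ∏ k ∈ Finset.univ.erase a, p (v k)) ≤ p (v a - w) * P := by
        rw [hP, mul_left_comm]
        refine mul_le_mul_of_nonneg_left ?_ (apply_nonneg _ _)
        exact mul_le_mul_of_nonneg_right (le_abs_self C)
          (Finset.prod_nonneg fun _ _ => apply_nonneg _ _)
      nlinarith [apply_nonneg p (v a - w)]
  have htop : x ∈ Submodule.span 𝕜 (Set.range (PiTensorProduct.tprod 𝕜 (s := fun _ : Fin n => V))) := by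
    rw [PiTensorProduct.span_tprod_eq_top]
    trivial
  refine Submodule.span_le.2 ?_ htop
  rintro _ ⟨v, rfl⟩
  exact key Finset.univ v (by simp)

/-- The functional `φ 1 ⊗ ⋯ ⊗ φ n` on the `n`-th tensor power. -/
def tensorPowFunctional {n : ℕ} (φ : Fin n → V →ₗ[𝕜] 𝕜) : ⨂[𝕜]^n V →ₗ[𝕜] 𝕜 :=
  PiTensorProduct.lift ((MultilinearMap.mkPiAlgebra 𝕜 (Fin n) 𝕜).compLinearMap φ)

@[simp]
theorem tensorPowFunctional_tprod {n : ℕ} (φ : Fin n → V →ₗ[𝕜] 𝕜) (v : Fin n → V) :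
    tensorPowFunctional φ (PiTensorProduct.tprod 𝕜 v) = ∏ k, φ k (v k) := by
  simp [tensorPowFunctional]

theorem tensorFunctional_apply {n : ℕ} (φ : Fin n → V →ₗ[𝕜] 𝕜) (x : TensorAlg 𝕜 V) :
    tensorFunctional φ x = tensorPowFunctional φ (x n) := rfl

theorem norm_tensorPowFunctional_le {n : ℕ} {φ : Fin n → V →ₗ[𝕜] 𝕜} {q : Seminorm 𝕜 V}
    (h : ∀ k v, ‖φ k v‖ ≤ q v) (x : ⨂[𝕜]^n V) :
    ‖tensorPowFunctional φ x‖ ≤ tensorPowSeminorm q n x := by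
  refine le_tensorPowSeminorm (r := (normSeminorm 𝕜 𝕜).comp (tensorPowFunctional φ)) (fun v => ?_) x
  rw [Seminorm.comp_apply, tensorPowFunctional_tprod, coe_normSeminorm, norm_prod]
  exact Finset.prod_le_prod (fun _ _ => norm_nonneg _) fun k _ => h k (v k)

/-- The estimate for an absolute basis carries over to the tensor powers. -/
theorem AbsEstimate.sum_tensorPow_le {I : Type*} {e : I → V} {φ : I → V →ₗ[𝕜] 𝕜}
    {p q : Seminorm 𝕜 V} (h : AbsEstimate e φ p q) {n : ℕ} (x : ⨂[𝕜]^n V)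
    (A : Finset (Fin n → I)) :
    ∑ t ∈ A, ‖tensorPowFunctional (fun k => φ (t k)) x‖ * ∏ k, p (e (t k)) ≤
      tensorPowSeminorm q n x := by
  classical
  -- The finite sum is itself a seminorm in `x`, so maximality of the projective seminorm applies to
  -- it.
  set r : Seminorm 𝕜 (⨂[𝕜]^n V) := ∑ t ∈ A, (normSeminorm 𝕜 𝕜).comp
    (((∏ k, p (e (t k)) : ℝ) : 𝕜) • tensorPowFunctional fun k => φ (t k)) with hr
  have hr' : ∀ y, r y = ∑ t ∈ A, ‖tensorPowFunctional (fun k => φ (t k)) y‖ *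
      ∏ k, p (e (t k)) := by
    intro y
    rw [hr, ← FunLike.coeAddMonoidHom_apply, map_sum, Finset.sum_apply]
    refine Finset.sum_congr rfl fun t _ => ?_
    rw [FunLike.coeAddMonoidHom_apply, Seminorm.comp_apply, LinearMap.smul_apply,
      coe_normSeminorm, norm_smul, RCLike.norm_ofReal,
      abs_of_nonneg (Finset.prod_nonneg fun k _ => apply_nonneg p _), mul_comm]
  rw [← hr']
  refine le_tensorPowSeminorm (fun v => ?_) x
  rw [hr']
  -- All indices occurring in `A`: enlarging `A` to the box of tuples in `J` turns the sum into a
  -- product.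
  set J : Finset I := A.biUnion fun t => Finset.univ.image t
  calc ∑ t ∈ A, ‖tensorPowFunctional (fun k => φ (t k)) (PiTensorProduct.tprod 𝕜 v)‖ *
        ∏ k, p (e (t k))
      = ∑ t ∈ A, ∏ k, ‖φ (t k) (v k)‖ * p (e (t k)) := by
        refine Finset.sum_congr rfl fun t _ => ?_
        rw [tensorPowFunctional_tprod, norm_prod, Finset.prod_mul_distrib]
    _ ≤ ∑ t ∈ Fintype.piFinset fun _ : Fin n => J, ∏ k, ‖φ (t k) (v k)‖ * p (e (t k)) := by
        refine Finset.sum_le_sum_of_subset_of_nonneg (fun t ht => ?_) fun t _ _ =>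
          Finset.prod_nonneg fun k _ => mul_nonneg (norm_nonneg _) (apply_nonneg _ _)
        refine Fintype.mem_piFinset.2 fun k => Finset.mem_biUnion.2 ⟨t, ht, by simp⟩
    _ = ∏ k, ∑ i ∈ J, ‖φ i (v k)‖ * p (e i) := by
        rw [Finset.prod_univ_sum]
    _ ≤ ∏ k, q (v k) := by
        refine Finset.prod_le_prod (fun k _ => Finset.sum_nonneg fun i _ =>
          mul_nonneg (norm_nonneg _) (apply_nonneg _ _)) fun k _ => ?_
        exact ((h (v k)).1.sum_le_tsum J fun i _ =>
          mul_nonneg (norm_nonneg _) (apply_nonneg _ _)).trans (h (v k)).2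

end TensorPowSeminorm

/-! ### The graded action of the symmetric group -/

/-- A product of symmetric factors runs over unordered pairs, and `τ` permutes these. -/
theorem Equiv.Perm.prod_lt_comp {M : Type*} [CommMonoid M] {n : ℕ} (τ : Equiv.Perm (Fin n))
    {h : Fin n → Fin n → M} (hh : ∀ i j, h i j = h j i) :
    ∏ x : Fin n × Fin n with x.1 < x.2, h (τ x.1) (τ x.2) =
      ∏ x : Fin n × Fin n with x.1 < x.2, h x.1 x.2 := by
  refine Finset.prod_bij' (fun x _ => (min (τ x.1) (τ x.2), max (τ x.1) (τ x.2)))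
    (fun x _ => (min (τ.symm x.1) (τ.symm x.2), max (τ.symm x.1) (τ.symm x.2))) ?_ ?_ ?_ ?_ ?_
  · rintro ⟨i, j⟩ hij
    simp only [Finset.mem_filter, Finset.mem_univ, true_and] at hij ⊢
    simp [hij.ne']
  · rintro ⟨i, j⟩ hij
    simp only [Finset.mem_filter, Finset.mem_univ, true_and] at hij ⊢
    simp [hij.ne']
  · rintro ⟨i, j⟩ hij
    simp only [Finset.mem_filter, Finset.mem_univ, true_and] at hij ⊢
    rcases le_total (τ i) (τ j) with h | h <;> simp [h, hij.le]
  · rintro ⟨i, j⟩ hij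
    simp only [Finset.mem_filter, Finset.mem_univ, true_and] at hij ⊢
    rcases le_total (τ.symm i) (τ.symm j) with h | h <;> simp [h, hij.le]
  · rintro ⟨i, j⟩ hij
    rcases le_total (τ i) (τ j) with h | h
    · simp [h]
    · simp [h, hh (τ i) (τ j)]

/-- The contribution of the pair `i`, `j` to the Koszul sign, in a form symmetric in `i` and `j`. -/
def koszulFactor {n : ℕ} (ε : Fin n → ZMod 2) (σ : Equiv.Perm (Fin n)) (i j : Fin n) : ℤ :=
  if (i < j ↔ σ j < σ i) ∧ ε (σ i) = 1 ∧ ε (σ j) = 1 then -1 else 1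

theorem koszulSign_eq_prod {n : ℕ} (ε : Fin n → ZMod 2) (σ : Equiv.Perm (Fin n)) :
    koszulSign ε σ = ∏ x : Fin n × Fin n with x.1 < x.2, koszulFactor ε σ x.1 x.2 := by
  rw [koszulSign, ← Finset.prod_product', Finset.prod_filter]
  refine Finset.prod_congr rfl fun x _ => ?_
  by_cases h : x.1 < x.2 <;> simp [koszulFactor, h]

/-- A pair is inverted by `σ * τ` exactly when one, but not both, of the following holds: `τ`
inverts it, or `σ` inverts its image under `τ`. Reindexing the sign of `σ` along `τ` allows a
comparison pair by pair. -/
theorem koszulSign_mul {n : ℕ} (ε : Fin n → ZMod 2) (σ τ : Equiv.Perm (Fin n)) :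
    koszulSign ε (σ * τ) = koszulSign ε σ * koszulSign (ε ∘ σ) τ := by
  have hs : ∀ i j, (if i = j then 1 else koszulFactor ε σ i j) =
      if j = i then 1 else koszulFactor ε σ j i := by
    intro i j
    by_cases hij : i = j
    · simp [hij]
    have h1 : (σ i : Fin n) ≠ σ j := σ.injective.ne hij
    rw [if_neg hij, if_neg (Ne.symm hij), koszulFactor, koszulFactor]
    congr 1
    rw [and_comm (a := ε (σ i) = 1)]
    have : (i < j ↔ σ j < σ i) ↔ (j < i ↔ σ i < σ j) := by
      have h2 : j < i ↔ ¬ i < j := ⟨fun h => h.not_gt, fun h => lt_of_le_of_ne (not_lt.1 h) (Ne.symm hij)⟩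
      have h3 : σ j < σ i ↔ ¬ σ i < σ j :=
        ⟨fun h => h.not_gt, fun h => lt_of_le_of_ne (not_lt.1 h) (Ne.symm h1)⟩
      rw [h2, h3]
      tauto
    rw [this]
  have hσ : koszulSign ε σ = ∏ x : Fin n × Fin n with x.1 < x.2,
      koszulFactor ε σ (τ x.1) (τ x.2) := by
    rw [koszulSign_eq_prod]
    have := τ.prod_lt_comp hs
    rw [Finset.prod_congr (s₂ := Finset.univ.filter fun x : Fin n × Fin n => x.1 < x.2)
      (g := fun x => koszulFactor ε σ (τ x.1) (τ x.2)) rfl] at this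
    · rw [this]
      refine Finset.prod_congr rfl fun x hx => ?_
      rw [if_neg (Finset.mem_filter.1 hx).2.ne]
    · intro x hx
      rw [if_neg (τ.injective.ne (Finset.mem_filter.1 hx).2.ne)]
  rw [hσ, koszulSign_eq_prod, koszulSign_eq_prod, ← Finset.prod_mul_distrib]
  refine Finset.prod_congr rfl fun x hx => ?_
  obtain ⟨i, j⟩ := x
  have hij : i < j := (Finset.mem_filter.1 hx).2
  have h1 : τ i ≠ τ j := τ.injective.ne hij.ne
  have h2 : σ (τ i) ≠ σ (τ j) := σ.injective.ne h1
  simp only [koszulFactor, Equiv.Perm.mul_apply, Function.comp_apply, hij, true_iff]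
  rcases h1.lt_or_gt with h | h <;> rcases h2.lt_or_gt with h' | h' <;>
    by_cases ha : ε (σ (τ i)) = 1 <;> by_cases hb : ε (σ (τ j)) = 1 <;>
    simp [h, h', h.not_gt, h'.not_gt, ha, hb]

theorem koszulSign_eq_or {n : ℕ} (ε : Fin n → ZMod 2) (σ : Equiv.Perm (Fin n)) :
    koszulSign ε σ = 1 ∨ koszulSign ε σ = -1 := by
  refine Int.isUnit_iff.1 (IsUnit.prod_univ_iff.2 fun i => IsUnit.prod_univ_iff.2 fun j => ?_)
  split_ifs <;> simp

theorem norm_koszulSign {𝕜 : Type*} [RCLike 𝕜] {n : ℕ} (ε : Fin n → ZMod 2)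
    (σ : Equiv.Perm (Fin n)) : ‖(koszulSign ε σ : 𝕜)‖ = 1 := by
  rcases koszulSign_eq_or ε σ with h | h <;> simp [h]

/-! ### The graded permutations, the symmetrizer and their seminorm bounds -/

section Graded

variable {𝕜 V : Type*} [RCLike 𝕜] [AddCommGroup V] [Module 𝕜 V]
variable (𝒱 : ZMod 2 → Submodule 𝕜 V) [DirectSum.Decomposition 𝒱]

theorem parityProj_apply (a : ZMod 2) (v : V) :
    parityProj 𝒱 a v = (DirectSum.decompose 𝒱 v a : V) := rfl

theorem parityProj_mem (a : ZMod 2) (v : V) : parityProj 𝒱 a v ∈ 𝒱 a :=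
  (DirectSum.decompose 𝒱 v a).2

theorem parityProj_of_mem {a : ZMod 2} {v : V} (h : v ∈ 𝒱 a) : parityProj 𝒱 a v = v :=
  DirectSum.decompose_of_mem_same 𝒱 h

theorem parityProj_of_mem_of_ne {a b : ZMod 2} {v : V} (h : v ∈ 𝒱 a) (hab : a ≠ b) :
    parityProj 𝒱 b v = 0 :=
  DirectSum.decompose_of_mem_ne 𝒱 h hab

theorem sum_parityProj (v : V) : ∑ a, parityProj 𝒱 a v = v := by
  classical
  conv_rhs => rw [← DirectSum.sum_support_decompose 𝒱 v]
  refine (Finset.sum_subset (Finset.subset_univ _) fun a _ ha => ?_).symm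
  rw [parityProj_apply, DFinsupp.notMem_support_iff.1 ha, ZeroMemClass.coe_zero]

theorem gradedPerm_tprod {n : ℕ} (σ : Equiv.Perm (Fin n)) (v : Fin n → V) :
    gradedPerm 𝒱 σ (PiTensorProduct.tprod 𝕜 v) = ∑ ε : Fin n → ZMod 2,
      (koszulSign ε σ : 𝕜) • PiTensorProduct.tprod 𝕜 fun k => parityProj 𝒱 (ε (σ k)) (v (σ k)) := by
  rw [gradedPerm, LinearMap.sum_apply]
  refine Finset.sum_congr rfl fun ε _ => ?_
  rw [LinearMap.smul_apply, LinearMap.comp_apply]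
  rw [PiTensorProduct.map_tprod]
  exact congrArg _ (PiTensorProduct.reindex_tprod _ _)

theorem gradedPerm_tprod_of_mem {n : ℕ} (σ : Equiv.Perm (Fin n)) {ε : Fin n → ZMod 2}
    {v : Fin n → V} (hv : ∀ k, v k ∈ 𝒱 (ε k)) :
    gradedPerm 𝒱 σ (PiTensorProduct.tprod 𝕜 v) =
      (koszulSign ε σ : 𝕜) • PiTensorProduct.tprod 𝕜 (v ∘ σ) := by
  rw [gradedPerm_tprod, Finset.sum_eq_single ε]
  · congr 2
    funext k
    exact parityProj_of_mem 𝒱 (hv (σ k))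
  · intro δ _ hδ
    obtain ⟨k, hk⟩ := Function.ne_iff.1 hδ
    rw [(PiTensorProduct.tprod 𝕜).map_coord_zero (σ.symm k), smul_zero]
    simpa using parityProj_of_mem_of_ne 𝒱 (hv k) hk.symm
  · simp

theorem tprod_eq_sum_parityProj {n : ℕ} (v : Fin n → V) :
    PiTensorProduct.tprod 𝕜 v = ∑ ε : Fin n → ZMod 2,
      PiTensorProduct.tprod 𝕜 fun k => parityProj 𝒱 (ε k) (v k) := by
  classical
  conv_lhs => rw [← funext fun k => sum_parityProj 𝒱 (v k)]
  exact (PiTensorProduct.tprod 𝕜).map_sum fun k a => parityProj 𝒱 a (v k)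

/-- Linear maps on a tensor power agree if they agree on tensors of homogeneous vectors. -/
theorem tensorPow_hom_ext {F : Type*} [AddCommGroup F] [Module 𝕜 F] {n : ℕ}
    {f g : ⨂[𝕜]^n V →ₗ[𝕜] F}
    (h : ∀ (ε : Fin n → ZMod 2) (v : Fin n → V), (∀ k, v k ∈ 𝒱 (ε k)) →
      f (PiTensorProduct.tprod 𝕜 v) = g (PiTensorProduct.tprod 𝕜 v)) : f = g := by
  refine PiTensorProduct.ext (MultilinearMap.ext fun v => ?_)
  simp only [LinearMap.compMultilinearMap_apply]
  rw [tprod_eq_sum_parityProj 𝒱 v, map_sum, map_sum]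
  exact Finset.sum_congr rfl fun ε _ => h ε _ fun k => parityProj_mem 𝒱 _ _

/-- On homogeneous tensors this is the cocycle identity `koszulSign_mul`; the order of the factors
reflects a right action. -/
theorem gradedPerm_gradedPerm {n : ℕ} (σ τ : Equiv.Perm (Fin n)) (x : ⨂[𝕜]^n V) :
    gradedPerm 𝒱 τ (gradedPerm 𝒱 σ x) = gradedPerm 𝒱 (σ * τ) x := by
  rw [← LinearMap.comp_apply]
  congr 1
  refine tensorPow_hom_ext 𝒱 fun ε v hv => ?_
  rw [LinearMap.comp_apply, gradedPerm_tprod_of_mem 𝒱 σ hv, gradedPerm_tprod_of_mem 𝒱 _ hv, map_smul,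
    gradedPerm_tprod_of_mem 𝒱 τ (ε := ε ∘ σ) (v := v ∘ σ) fun k => hv (σ k), smul_smul, koszulSign_mul]
  push_cast
  rfl

theorem symmetrizerPow_apply {n : ℕ} (x : ⨂[𝕜]^n V) :
    symmetrizerPow 𝒱 n x = (n.factorial : 𝕜)⁻¹ • ∑ σ, gradedPerm 𝒱 σ x := by
  rw [symmetrizerPow, LinearMap.smul_apply, LinearMap.sum_apply]

theorem symmetrizerPow_gradedPerm {n : ℕ} (σ : Equiv.Perm (Fin n)) (x : ⨂[𝕜]^n V) :
    symmetrizerPow 𝒱 n (gradedPerm 𝒱 σ x) = symmetrizerPow 𝒱 n x := by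
  rw [symmetrizerPow_apply, symmetrizerPow_apply]
  congr 1
  simp only [gradedPerm_gradedPerm]
  exact Fintype.sum_equiv (Equiv.mulLeft σ) _ _ fun τ => rfl

theorem symmetrizerPow_symmetrizerPow {n : ℕ} (x : ⨂[𝕜]^n V) :
    symmetrizerPow 𝒱 n (symmetrizerPow 𝒱 n x) = symmetrizerPow 𝒱 n x := by
  conv_lhs => rw [symmetrizerPow_apply 𝒱 x]
  rw [map_smul, map_sum]
  simp only [symmetrizerPow_gradedPerm]
  rw [Finset.sum_const, Finset.card_univ, Fintype.card_perm, Fintype.card_fin, ← Nat.cast_smul_eq_nsmul 𝕜,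
    smul_smul, inv_mul_cancel₀ (Nat.cast_ne_zero.2 n.factorial_ne_zero), one_smul]

theorem symmetrizer_apply (x : TensorAlg 𝕜 V) (n : ℕ) :
    symmetrizer 𝒱 x n = symmetrizerPow 𝒱 n (x n) :=
  DirectSum.lmap_apply _ _ _

theorem symmetrizer_symmetrizer (x : TensorAlg 𝕜 V) :
    symmetrizer 𝒱 (symmetrizer 𝒱 x) = symmetrizer 𝒱 x :=
  DFinsupp.ext fun n => by
    rw [symmetrizer_apply, symmetrizer_apply, symmetrizerPow_symmetrizerPow]

theorem symmetrizer_coe (v : GradedSym 𝒱) : symmetrizer 𝒱 v = v := by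
  obtain ⟨_, x, rfl⟩ := v
  exact symmetrizer_symmetrizer 𝒱 x

theorem symmetrizer_lof {n : ℕ} (x : ⨂[𝕜]^n V) :
    symmetrizer 𝒱 (DirectSum.lof 𝕜 ℕ (fun n => ⨂[𝕜]^n V) n x) =
      DirectSum.lof 𝕜 ℕ (fun n => ⨂[𝕜]^n V) n (symmetrizerPow 𝒱 n x) :=
  DirectSum.lmap_lof _ _ _

/-- Norm estimates for the symmetrizer follow from estimates for the graded permutations. -/
theorem seminorm_symmetrizerPow_le {n : ℕ} {r : Seminorm 𝕜 (⨂[𝕜]^n V)} {x : ⨂[𝕜]^n V} {C : ℝ}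
    (h : ∀ σ, r (gradedPerm 𝒱 σ x) ≤ C) : r (symmetrizerPow 𝒱 n x) ≤ C := by
  rw [symmetrizerPow_apply, map_smul_eq_mul, norm_inv, RCLike.norm_natCast,
    inv_mul_le_iff₀ (by positivity)]
  refine (Finset.le_sum_of_subadditive r (map_zero r).le (map_add_le_add r) _ _).trans ((Finset.sum_le_sum fun σ _ => h σ).trans_eq ?_)
  rw [Finset.sum_const, Finset.card_univ, Fintype.card_perm, Fintype.card_fin, nsmul_eq_mul]

theorem tensorPowSeminorm_symmetrizerPow_tprod_le (p : Seminorm 𝕜 V) {n : ℕ} {v : Fin n → V}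
    (hv : ∀ k, SetLike.IsHomogeneousElem 𝒱 (v k)) :
    tensorPowSeminorm p n (symmetrizerPow 𝒱 n (PiTensorProduct.tprod 𝕜 v)) ≤ ∏ k, p (v k) := by
  choose ε hε using hv
  refine seminorm_symmetrizerPow_le 𝒱 fun σ => ?_
  rw [gradedPerm_tprod_of_mem 𝒱 σ hε, map_smul_eq_mul, norm_koszulSign, one_mul]
  exact (tensorPowSeminorm_tprod_le p _).trans_eq (Equiv.prod_comp σ fun k => p (v k))

/-- The sum of the seminorms of the homogeneous components. -/
def gradedSeminorm (p : Seminorm 𝕜 V) : Seminorm 𝕜 V := ∑ a, p.comp (parityProj 𝒱 a)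

theorem gradedSeminorm_apply (p : Seminorm 𝕜 V) (v : V) :
    gradedSeminorm 𝒱 p v = ∑ a, p (parityProj 𝒱 a v) := by
  rw [gradedSeminorm, ← FunLike.coeAddMonoidHom_apply, map_sum, Finset.sum_apply]
  rfl

theorem continuous_gradedSeminorm [TopologicalSpace V] (h𝒱 : ∀ a, Continuous (parityProj 𝒱 a))
    {p : Seminorm 𝕜 V} (hp : Continuous p) : Continuous (gradedSeminorm 𝒱 p) := by
  rw [show ⇑(gradedSeminorm 𝒱 p) = fun v => ∑ a, p (parityProj 𝒱 a v) from
    funext (gradedSeminorm_apply 𝒱 p)]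
  exact continuous_finsetSum _ fun a _ => hp.comp (h𝒱 a)

/-- Expanding each entry into its parity components reduces to the homogeneous case. The density
argument needs this bound for arbitrary vectors. -/
theorem tensorPowSeminorm_symmetrizerPow_tprod_le_graded (p : Seminorm 𝕜 V) {n : ℕ}
    (v : Fin n → V) :
    tensorPowSeminorm p n (symmetrizerPow 𝒱 n (PiTensorProduct.tprod 𝕜 v)) ≤
      ∏ k, gradedSeminorm 𝒱 p (v k) := by
  classical
  simp only [gradedSeminorm_apply]
  rw [tprod_eq_sum_parityProj 𝒱, map_sum, Finset.prod_univ_sum, Fintype.piFinset_univ]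
  refine (Finset.le_sum_of_subadditive _ (map_zero _).le (map_add_le_add _) _ _).trans (Finset.sum_le_sum fun ε _ => ?_)
  exact tensorPowSeminorm_symmetrizerPow_tprod_le 𝒱 p fun k => ⟨_, parityProj_mem 𝒱 _ _⟩

end Graded

/-! ### Rearrangements of a tuple -/

theorem rearrangements_comp {I : Type*} {n : ℕ} (t : Fin n → I) (σ : Equiv.Perm (Fin n)) :
    rearrangements (t ∘ σ) = rearrangements t := by
  refine Nat.card_congr (Equiv.subtypeEquivRight fun s => ⟨?_, ?_⟩)
  · rintro ⟨τ, rfl⟩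
    exact ⟨σ * τ, rfl⟩
  · rintro ⟨τ, rfl⟩
    exact ⟨σ⁻¹ * τ, by ext k; simp⟩

/-- Orbit-stabilizer: the fibres of `σ ↦ t ∘ σ` are cosets of the stabilizer of `t`. -/
theorem rearrangements_mul_card {I : Type*} {n : ℕ} (t : Fin n → I) :
    rearrangements t * Nat.card {σ : Equiv.Perm (Fin n) // t = t ∘ σ} = n.factorial := by
  classical
  let O := {s : Fin n → I // ∃ σ : Equiv.Perm (Fin n), s = t ∘ σ}
  let f : Equiv.Perm (Fin n) → O := fun σ => ⟨t ∘ σ, σ, rfl⟩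
  have e1 : Equiv.Perm (Fin n) ≃ Σ s : O, {σ // f σ = s} := (Equiv.sigmaFiberEquiv f).symm
  have e2 : ∀ s : O, {σ // f σ = s} ≃ {σ : Equiv.Perm (Fin n) // t = t ∘ σ} := by
    rintro ⟨s, h⟩
    have hτ := h.choose_spec
    set τ := h.choose
    refine (Equiv.mulRight τ⁻¹).subtypeEquiv fun σ => ?_
    rw [Subtype.ext_iff]
    change t ∘ σ = s ↔ t = t ∘ (σ * τ⁻¹)
    rw [hτ]
    clear_value τ
    constructor
    · intro h
      ext k
      simpa using (congrFun h (τ⁻¹ k)).symm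
    · intro h
      ext k
      simpa using (congrFun h (τ k)).symm
  have e3 := (e1.trans (Equiv.sigmaCongrRight e2)).trans (Equiv.sigmaEquivProd _ _)
  rw [rearrangements, ← Nat.card_prod, ← Nat.card_congr e3, Nat.card_perm, Nat.card_fin]

theorem rearrangements_ne_zero {I : Type*} {n : ℕ} (t : Fin n → I) : rearrangements t ≠ 0 :=
  left_ne_zero_of_mul (rearrangements_mul_card t ▸ n.factorial_ne_zero)

/-! ### Symmetrized products and functionals -/

theorem eq_one_of_eq_smul_self {𝕜 E : Type*} [Field 𝕜] [AddCommGroup E] [Module 𝕜 E] {c : 𝕜} {x : E}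
    (h : x = c • x) (hx : x ≠ 0) : c = 1 := by
  by_contra hc
  refine hx ((smul_eq_zero.1 ?_).resolve_left (sub_ne_zero.2 hc))
  rw [sub_smul, ← h, one_smul, sub_self]

section Sym

variable {𝕜 V I : Type*} [RCLike 𝕜] [AddCommGroup V] [Module 𝕜 V]
variable (𝒱 : ZMod 2 → Submodule 𝕜 V) [DirectSum.Decomposition 𝒱]

theorem coe_symProd {n : ℕ} (v : Fin n → V) :
    (symProd 𝒱 v : TensorAlg 𝕜 V) =
      DirectSum.lof 𝕜 ℕ (fun n => ⨂[𝕜]^n V) n (symmetrizerPow 𝒱 n (PiTensorProduct.tprod 𝕜 v)) :=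
  symmetrizer_lof 𝒱 _

theorem coe_symProd_apply_self {n : ℕ} (v : Fin n → V) :
    (symProd 𝒱 v : TensorAlg 𝕜 V) n = symmetrizerPow 𝒱 n (PiTensorProduct.tprod 𝕜 v) := by
  rw [coe_symProd, DirectSum.lof_apply]

theorem coe_symProd_apply_of_ne {n m : ℕ} (h : m ≠ n) (v : Fin n → V) :
    (symProd 𝒱 v : TensorAlg 𝕜 V) m = 0 := by
  rw [coe_symProd, DirectSum.lof_eq_of, DirectSum.of_eq_of_ne _ _ _ h]

/-- The symmetrizer absorbs graded permutations, and the sign is its own inverse. -/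
theorem symProd_comp_perm {n : ℕ} (σ : Equiv.Perm (Fin n)) {ε : Fin n → ZMod 2} {v : Fin n → V}
    (hv : ∀ k, v k ∈ 𝒱 (ε k)) :
    symProd 𝒱 (v ∘ σ) = (koszulSign ε σ : 𝕜) • symProd 𝒱 v := by
  have h : symmetrizerPow 𝒱 n (PiTensorProduct.tprod 𝕜 v) =
      (koszulSign ε σ : 𝕜) • symmetrizerPow 𝒱 n (PiTensorProduct.tprod 𝕜 (v ∘ σ)) := by
    rw [← symmetrizerPow_gradedPerm 𝒱 σ, gradedPerm_tprod_of_mem 𝒱 σ hv, map_smul]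
  refine Subtype.ext ?_
  rw [Submodule.coe_smul, coe_symProd, coe_symProd, h, ← map_smul, smul_smul]
  rcases koszulSign_eq_or ε σ with h | h <;> simp [h]

/-- Elements of the symmetric algebra are fixed by the symmetrizer, so bounds for the plain tensor
functional carry over without loss. -/
theorem symFunctional_apply {n : ℕ} (φ : Fin n → V →ₗ[𝕜] 𝕜) (v : GradedSym 𝒱) :
    symFunctional 𝒱 φ v = tensorPowFunctional φ ((v : TensorAlg 𝕜 V) n) := by
  rw [← tensorFunctional_apply]
  exact congrArg (tensorFunctional φ) (symmetrizer_coe 𝒱 v)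

theorem symSeminorm_apply (p : Seminorm 𝕜 V) (R : ℝ) (v : GradedSym 𝒱) :
    symSeminorm 𝒱 p R v = weightedSeminorm p R v := rfl

theorem symSeminorm_mono {p q : Seminorm 𝕜 V} (h : p ≤ q) (R : ℝ) :
    symSeminorm 𝒱 p R ≤ symSeminorm 𝒱 q R := fun v => weightedSeminorm_mono h R (v : TensorAlg 𝕜 V)

theorem norm_symFunctional_le {n : ℕ} {φ : Fin n → V →ₗ[𝕜] 𝕜} {q : Seminorm 𝕜 V}
    (h : ∀ k v, ‖φ k v‖ ≤ q v) (R : ℝ) (v : GradedSym 𝒱) :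
    ‖symFunctional 𝒱 φ v‖ ≤ ((n.factorial : ℝ) ^ R)⁻¹ * symSeminorm 𝒱 q R v := by
  rw [symFunctional_apply, le_inv_mul_iff₀ (by positivity), mul_comm]
  exact (mul_le_mul_of_nonneg_right (norm_tensorPowFunctional_le h _) (by positivity)).trans
    (tensorPowSeminorm_mul_le_weightedSeminorm q R _ n)

theorem symSeminorm_symProd_le (p : Seminorm 𝕜 V) (R : ℝ) {n : ℕ} {v : Fin n → V}
    (hv : ∀ k, SetLike.IsHomogeneousElem 𝒱 (v k)) :
    symSeminorm 𝒱 p R (symProd 𝒱 v) ≤ (∏ k, p (v k)) * (n.factorial : ℝ) ^ R := by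
  rw [symSeminorm_apply, coe_symProd, weightedSeminorm_lof]
  exact mul_le_mul_of_nonneg_right (tensorPowSeminorm_symmetrizerPow_tprod_le 𝒱 p hv)
    (by positivity)

variable {e : I → V} {φ : I → V →ₗ[𝕜] 𝕜}

/-- The absolute estimate for the family of all symmetrized products. -/
theorem AbsEstimate.gradedSym {p q : Seminorm 𝕜 V} (h : AbsEstimate e φ p q)
    (hhom : ∀ i, SetLike.IsHomogeneousElem 𝒱 (e i)) (R : ℝ) :
    AbsEstimate (fun t : Σ n : ℕ, Fin n → I => symProd 𝒱 (fun k => e (t.2 k)))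
      (fun t => symFunctional 𝒱 (fun k => φ (t.2 k))) (symSeminorm 𝒱 p R) (symSeminorm 𝒱 q R) := by
  intro v
  set f : (Σ n : ℕ, Fin n → I) → ℝ := fun t =>
    ‖symFunctional 𝒱 (fun k => φ (t.2 k)) v‖ * symSeminorm 𝒱 p R (symProd 𝒱 fun k => e (t.2 k))
    with hf
  have hf0 : ∀ t, 0 ≤ f t := fun t => mul_nonneg (norm_nonneg _) (apply_nonneg _ _)
  have hsum : ∀ n (A : Finset (Fin n → I)), ∑ t ∈ A, f ⟨n, t⟩ ≤
      tensorPowSeminorm q n ((v : TensorAlg 𝕜 V) n) * (n.factorial : ℝ) ^ R := by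
    intro n A
    refine le_trans ?_ (mul_le_mul_of_nonneg_right
      (h.sum_tensorPow_le ((v : TensorAlg 𝕜 V) n) A) (by positivity))
    rw [Finset.sum_mul]
    refine Finset.sum_le_sum fun t _ => ?_
    simp only [hf]
    rw [symFunctional_apply, mul_assoc]
    exact mul_le_mul_of_nonneg_left (symSeminorm_symProd_le 𝒱 p R fun k => hhom _) (norm_nonneg _)
  have hfib : ∀ n, Summable fun t : Fin n → I => f ⟨n, t⟩ := fun n =>
    summable_of_sum_le (fun t => hf0 _) (hsum n)
  have hle : ∀ n, ∑' t : Fin n → I, f ⟨n, t⟩ ≤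
      tensorPowSeminorm q n ((v : TensorAlg 𝕜 V) n) * (n.factorial : ℝ) ^ R := fun n =>
    (hfib n).tsum_le_of_sum_le (hsum n)
  have hout : Summable fun n => ∑' t : Fin n → I, f ⟨n, t⟩ :=
    Summable.of_nonneg_of_le (fun n => tsum_nonneg fun t => hf0 _) hle (summable_weighted q R _)
  have hS : Summable f := (summable_sigma_of_nonneg hf0).2 ⟨hfib, hout⟩
  refine ⟨hS, ?_⟩
  rw [hS.tsum_sigma' hfib]
  exact hout.tsum_le_tsum hle (summable_weighted q R _)

/-- The symmetrized products of vectors from a dense family span a dense subspace. -/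
theorem mem_closureSubmodule_symProd {p : Seminorm 𝕜 V}
    (he : ∀ v, v ∈ (gradedSeminorm 𝒱 p).closureSubmodule (Submodule.span 𝕜 (Set.range e)))
    (R : ℝ) (v : GradedSym 𝒱) :
    v ∈ (symSeminorm 𝒱 p R).closureSubmodule (Submodule.span 𝕜
      (Set.range fun t : Σ n : ℕ, Fin n → I => symProd 𝒱 fun k => e (t.2 k))) := by
  obtain ⟨_, x, rfl⟩ := v
  change (symmetrizer 𝒱).rangeRestrict x ∈ _
  induction x using DirectSum.induction_on with
  | zero => rw [map_zero]; exact Submodule.zero_mem _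
  | add x y hx hy => rw [map_add]; exact Submodule.add_mem _ hx hy
  | of n x =>
    set T : ⨂[𝕜]^n V →ₗ[𝕜] GradedSym 𝒱 :=
      (symmetrizer 𝒱).rangeRestrict ∘ₗ DirectSum.lof 𝕜 ℕ (fun n => ⨂[𝕜]^n V) n
    have hT : ∀ y, (T y : TensorAlg 𝕜 V) =
        DirectSum.lof 𝕜 ℕ (fun n => ⨂[𝕜]^n V) n (symmetrizerPow 𝒱 n y) := fun y =>
      symmetrizer_lof 𝒱 y
    -- Density in the tensor power is pushed forward along `T`; the constant is the weight of degree
    -- `n`.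
    have h1 := Seminorm.map_mem_closureSubmodule (r := symSeminorm 𝒱 p R) T
      (mem_closureSubmodule_tprod he (C := (n.factorial : ℝ) ^ R) (fun w => ?_) x)
    · rw [Submodule.map_span, ← Set.range_comp] at h1
      intro ε hε
      obtain ⟨w, hw, hxw⟩ := h1 ε hε
      refine ⟨w, Submodule.span_mono ?_ hw, hxw⟩
      rintro _ ⟨t, rfl⟩
      exact ⟨⟨n, t⟩, rfl⟩
    · rw [Seminorm.comp_apply, symSeminorm_apply, hT, weightedSeminorm_lof, mul_comm]
      exact mul_le_mul_of_nonneg_left (tensorPowSeminorm_symmetrizerPow_tprod_le_graded 𝒱 p w)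
        (by positivity)

variable {ε : I → ZMod 2}

theorem symFunctional_symProd_of_ne {n m : ℕ} (h : n ≠ m) (ψ : Fin n → V →ₗ[𝕜] 𝕜)
    (v : Fin m → V) : symFunctional 𝒱 ψ (symProd 𝒱 v) = 0 := by
  rw [symFunctional_apply, coe_symProd_apply_of_ne 𝒱 h, map_zero]

theorem symFunctional_symProd {n : ℕ} (ψ : Fin n → V →ₗ[𝕜] 𝕜) {v : Fin n → V}
    {δ : Fin n → ZMod 2} (hv : ∀ k, v k ∈ 𝒱 (δ k)) :
    symFunctional 𝒱 ψ (symProd 𝒱 v) =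
      (n.factorial : 𝕜)⁻¹ * ∑ σ : Equiv.Perm (Fin n), koszulSign δ σ * ∏ k, ψ k (v (σ k)) := by
  rw [symFunctional_apply, coe_symProd_apply_self, symmetrizerPow_apply, map_smul, map_sum,
    smul_eq_mul]
  congr 1
  refine Finset.sum_congr rfl fun σ _ => ?_
  rw [gradedPerm_tprod_of_mem 𝒱 σ hv, map_smul, tensorPowFunctional_tprod, smul_eq_mul]
  rfl

theorem symFunctional_symProd_of_forall_ne (hφ : ∀ i j, i ≠ j → φ i (e j) = 0)
    (hε : ∀ i, e i ∈ 𝒱 (ε i)) {n : ℕ} {t s : Fin n → I}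
    (h : ∀ σ : Equiv.Perm (Fin n), t ≠ s ∘ σ) :
    symFunctional 𝒱 (fun k => φ (t k)) (symProd 𝒱 fun k => e (s k)) = 0 := by
  rw [symFunctional_symProd 𝒱 _ fun k => hε (s k), Finset.sum_eq_zero, mul_zero]
  intro σ _
  obtain ⟨k, hk⟩ := Function.ne_iff.1 (h σ)
  rw [Finset.prod_eq_zero (Finset.mem_univ k) (hφ _ _ hk), mul_zero]

/-- Only permutations fixing `t` contribute. Such a permutation maps the product to its Koszul sign
times itself, so the sign is `1` as the product is nonzero; the stabilizer is then counted. -/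
theorem rearrangements_mul_symFunctional_symProd (hφ1 : ∀ i, φ i (e i) = 1)
    (hφ : ∀ i j, i ≠ j → φ i (e j) = 0)
    (hε : ∀ i, e i ∈ 𝒱 (ε i)) {n : ℕ} {t : Fin n → I}
    (h : symProd 𝒱 (fun k => e (t k)) ≠ 0) :
    (rearrangements t : 𝕜) *
      symFunctional 𝒱 (fun k => φ (t k)) (symProd 𝒱 fun k => e (t k)) = 1 := by
  classical
  have hterm : ∀ σ : Equiv.Perm (Fin n),
      (koszulSign (fun k => ε (t k)) σ : 𝕜) * ∏ k, φ (t k) (e (t (σ k))) =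
        if t = t ∘ σ then 1 else 0 := by
    intro σ
    split_ifs with hσ
    · have h1 : ∀ k, t (σ k) = t k := fun k => (congrFun hσ k).symm
      have h2 := symProd_comp_perm 𝒱 σ (v := fun k => e (t k)) fun k => hε (t k)
      have h3 : (fun k => e (t k)) ∘ σ = fun k => e (t k) := funext fun k => congrArg e (h1 k)
      rw [h3] at h2
      have h4 : (koszulSign (fun k => ε (t k)) σ : 𝕜) = 1 :=
        eq_one_of_eq_smul_self (E := GradedSym 𝒱) h2 h
      rw [h4, one_mul]
      exact Finset.prod_eq_one fun k _ => by rw [h1, hφ1]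
    · obtain ⟨k, hk⟩ := Function.ne_iff.1 hσ
      rw [Finset.prod_eq_zero (Finset.mem_univ k) (hφ _ _ hk), mul_zero]
  rw [symFunctional_symProd 𝒱 _ fun k => hε (t k), Finset.sum_congr rfl fun σ _ => hterm σ,
    Finset.sum_boole, ← Fintype.card_subtype, ← Nat.card_eq_fintype_card, mul_left_comm,
    ← Nat.cast_mul, rearrangements_mul_card,
    inv_mul_cancel₀ (Nat.cast_ne_zero.2 n.factorial_ne_zero)]

theorem symFunctional_symProd_ne_zero (hφ1 : ∀ i, φ i (e i) = 1)
    (hφ : ∀ i j, i ≠ j → φ i (e j) = 0)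
    (hε : ∀ i, e i ∈ 𝒱 (ε i)) {n : ℕ} {t : Fin n → I}
    (h : symProd 𝒱 (fun k => e (t k)) ≠ 0) :
    symFunctional 𝒱 (fun k => φ (t k)) (symProd 𝒱 fun k => e (t k)) ≠ 0 :=
  right_ne_zero_of_mul_eq_one (rearrangements_mul_symFunctional_symProd 𝒱 hφ1 hφ hε h)

theorem exists_perm_of_symFunctional_symProd_ne_zero (hφ : ∀ i j, i ≠ j → φ i (e j) = 0)
    (hε : ∀ i, e i ∈ 𝒱 (ε i)) {t s : Σ n : ℕ, Fin n → I}
    (h : symFunctional 𝒱 (fun k => φ (s.2 k)) (symProd 𝒱 fun k => e (t.2 k)) ≠ 0) :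
    ∃ σ : Equiv.Perm (Fin t.1), s = ⟨t.1, t.2 ∘ σ⟩ := by
  obtain ⟨n, t⟩ := t
  obtain ⟨m, s⟩ := s
  obtain rfl : m = n := by
    by_contra hne
    exact h (symFunctional_symProd_of_ne 𝒱 hne _ _)
  by_contra! hne
  exact h (symFunctional_symProd_of_forall_ne 𝒱 hφ hε fun σ hσ => hne σ (congrArg (Sigma.mk m) hσ))

/-- Nonzero symmetrized products of basis vectors agree only if one arises from the other by a
rearrangement. -/
theorem exists_perm_of_symProd_eq (hφ1 : ∀ i, φ i (e i) = 1)
    (hφ : ∀ i j, i ≠ j → φ i (e j) = 0)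
    (hε : ∀ i, e i ∈ 𝒱 (ε i)) {t s : Σ n : ℕ, Fin n → I}
    (h : symProd 𝒱 (fun k => e (t.2 k)) = symProd 𝒱 fun k => e (s.2 k))
    (h0 : symProd 𝒱 (fun k => e (t.2 k)) ≠ 0) :
    ∃ σ : Equiv.Perm (Fin t.1), s = ⟨t.1, t.2 ∘ σ⟩ := by
  have h1 := symFunctional_symProd_ne_zero 𝒱 hφ1 hφ hε (h ▸ h0)
  rw [← h] at h1
  exact exists_perm_of_symFunctional_symProd_ne_zero 𝒱 hφ hε h1

/-! ### Density of the products and symmetry of the functionals -/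

section Topology

variable [TopologicalSpace V]

/-- The span of an absolute Schauder basis is dense for every continuous seminorm. -/
theorem IsAbsoluteSchauderBasis.mem_closureSubmodule [IsTopologicalAddGroup V]
    (he : IsAbsoluteSchauderBasis 𝕜 e φ)
    {p : Seminorm 𝕜 V} (hp : Continuous p) (v : V) :
    v ∈ p.closureSubmodule (Submodule.span 𝕜 (Set.range e)) := by
  intro ε hε
  have h1 : Filter.Tendsto (fun s : Finset I => p (v - ∑ i ∈ s, φ i v • e i)) Filter.atTop
      (nhds 0) := by
    have h2 := (hp.tendsto _).comp ((he.expansion v).const_sub v)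
    rwa [sub_self, map_zero] at h2
  obtain ⟨s, hs⟩ := (h1.eventually (gt_mem_nhds hε)).exists
  exact ⟨_, Submodule.sum_mem _ fun i _ => Submodule.smul_mem _ _ (Submodule.subset_span ⟨i, rfl⟩),
    hs⟩

theorem IsAbsoluteSchauderBasis.mem_closureSubmodule_symProd [IsTopologicalAddGroup V]
    (he : IsAbsoluteSchauderBasis 𝕜 e φ) (h𝒱 : ∀ a, Continuous (parityProj 𝒱 a))
    {p : Seminorm 𝕜 V} (hp : Continuous p) (R : ℝ) (v : GradedSym 𝒱) :
    v ∈ (symSeminorm 𝒱 p R).closureSubmodule (Submodule.span 𝕜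
      (Set.range fun t : Σ n : ℕ, Fin n → I => symProd 𝒱 fun k => e (t.2 k))) :=
  _root_.mem_closureSubmodule_symProd 𝒱
    (he.mem_closureSubmodule (continuous_gradedSeminorm 𝒱 h𝒱 hp)) R v

theorem IsAbsoluteSchauderBasis.exists_seminorm_coeff (he : IsAbsoluteSchauderBasis 𝕜 e φ)
    {n : ℕ} (t : Fin n → I) :
    ∃ q : Seminorm 𝕜 V, Continuous q ∧ ∀ k v, ‖φ (t k) v‖ ≤ q v := by
  have h : ∀ v, (∑ k, (normSeminorm 𝕜 𝕜).comp (φ (t k))) v = ∑ k, ‖φ (t k) v‖ := fun v => by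
    rw [← FunLike.coeAddMonoidHom_apply, map_sum, Finset.sum_apply]
    rfl
  refine ⟨∑ k, (normSeminorm 𝕜 𝕜).comp (φ (t k)), ?_, fun k v => ?_⟩
  · rw [show ⇑(∑ k, (normSeminorm 𝕜 𝕜).comp (φ (t k))) = fun v => ∑ k, ‖φ (t k) v‖ from funext h]
    exact continuous_finsetSum _ fun k _ => (he.continuous_coeff _).norm
  · rw [h]
    exact Finset.single_le_sum (f := fun k => ‖φ (t k) v‖) (fun _ _ => norm_nonneg _)
      (Finset.mem_univ k)

/-- Rearranging the factors of a symmetrized functional produces the same sign as for the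
corresponding product of basis vectors. -/
theorem IsAbsoluteSchauderBasis.symFunctional_comp_perm [IsTopologicalAddGroup V]
    (he : IsAbsoluteSchauderBasis 𝕜 e φ)
    (h𝒱 : ∀ a, Continuous (parityProj 𝒱 a)) (hε : ∀ i, e i ∈ 𝒱 (ε i)) {n : ℕ} {t : Fin n → I}
    (h : symProd 𝒱 (fun k => e (t k)) ≠ 0) (σ : Equiv.Perm (Fin n)) :
    symFunctional 𝒱 (fun k => φ (t (σ k))) =
      (koszulSign (fun k => ε (t k)) σ : 𝕜) • symFunctional 𝒱 fun k => φ (t k) := by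
  have hperm : ∀ ρ : Equiv.Perm (Fin n), symProd 𝒱 (fun k => e (t (ρ k))) =
      (koszulSign (fun k => ε (t k)) ρ : 𝕜) • symProd 𝒱 fun k => e (t k) := fun ρ =>
    symProd_comp_perm 𝒱 ρ (v := fun k => e (t k)) fun k => hε (t k)
  obtain ⟨q, hq, hqt⟩ := he.exists_seminorm_coeff t
  set c : 𝕜 := (koszulSign (fun k => ε (t k)) σ : 𝕜) with hc
  have hcc : c * c = 1 := by
    rcases koszulSign_eq_or (fun k => ε (t k)) σ with h | h <;> simp [hc, h]
  have hnc : ‖c‖ = 1 := norm_koszulSign _ _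
  -- The parities of the `φ i` are not given algebraically, so the identity is checked on the
  -- products of basis vectors and extended by continuity.
  rw [← sub_eq_zero]
  ext1 v
  rw [LinearMap.zero_apply]
  refine LinearMap.eq_zero_of_mem_closureSubmodule (C := 2 * ((n.factorial : ℝ) ^ (0 : ℝ))⁻¹)
    (fun x => ?_) (Submodule.span_le.2 ?_) (he.mem_closureSubmodule_symProd 𝒱 h𝒱 hq 0 v)
  · rw [LinearMap.sub_apply, LinearMap.smul_apply]
    refine (norm_sub_le _ _).trans ?_
    rw [norm_smul, hnc, one_mul]
    linarith [norm_symFunctional_le 𝒱 hqt 0 x, norm_symFunctional_le 𝒱 (fun k => hqt (σ k)) 0 x]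
  · rintro _ ⟨⟨m, s⟩, rfl⟩
    simp only [SetLike.mem_coe, LinearMap.mem_ker, LinearMap.sub_apply, LinearMap.smul_apply]
    by_cases hnm : n = m
    · subst hnm
      by_cases hs : ∃ ρ : Equiv.Perm (Fin n), s = t ∘ ρ
      · obtain ⟨ρ, rfl⟩ := hs
        simp only [Function.comp_apply]
        -- The tuples `t` and `t ∘ σ` have equally many rearrangements, so the two normalizations
        -- determine both values on the same product, up to the sign `c`.
        have h1 := rearrangements_mul_symFunctional_symProd 𝒱 he.coeff_self he.coeff_of_ne hε h
        have h2 := rearrangements_mul_symFunctional_symProd 𝒱 he.coeff_self he.coeff_of_ne hε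
          (t := t ∘ σ) (by
            simp only [Function.comp_apply]
            rw [hperm]
            exact smul_ne_zero (left_ne_zero_of_mul_eq_one hcc) h)
        simp only [Function.comp_apply] at h2
        rw [rearrangements_comp, hperm σ, map_smul, smul_eq_mul] at h2
        have h3 : (rearrangements t : 𝕜) ≠ 0 := Nat.cast_ne_zero.2 (rearrangements_ne_zero t)
        rw [hperm ρ, map_smul, map_smul, smul_comm c, ← smul_sub]
        refine smul_eq_zero_of_right _ (mul_left_cancel₀ h3 ?_)
        rw [smul_eq_mul, mul_sub, mul_zero, mul_left_comm, h1]
        linear_combination c * h2 - (rearrangements t : 𝕜) *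
          symFunctional 𝒱 (fun k => φ (t (σ k))) (symProd 𝒱 fun k => e (t k)) * hcc
      · have hz : ∀ τ : Equiv.Perm (Fin n),
            symFunctional 𝒱 (fun k => φ (t (τ k))) (symProd 𝒱 fun k => e (s k)) = 0 := fun τ =>
          symFunctional_symProd_of_forall_ne 𝒱 (t := t ∘ τ) he.coeff_of_ne hε fun ρ hρ =>
            hs ⟨τ * ρ⁻¹, by
              ext k
              simpa using (congrFun hρ (ρ⁻¹ k)).symm⟩
        have h1 := hz 1
        simp only [Equiv.Perm.one_apply] at h1
        rw [hz σ, h1, smul_zero, sub_zero]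
    · rw [symFunctional_symProd_of_ne 𝒱 hnm, symFunctional_symProd_of_ne 𝒱 hnm, smul_zero, sub_zero]

end Topology

end Sym

/-! ### A criterion for absolute Schauder bases -/

section Criterion

variable {𝕜 E ι κ : Type*} [RCLike 𝕜] [AddCommGroup E] [Module 𝕜 E]
variable {e : ι → E} {ψ : ι → E →ₗ[𝕜] 𝕜}

theorem AbsEstimate.mono_left {p p' q : Seminorm 𝕜 E} (h : AbsEstimate e ψ p' q) (hp : p ≤ p') :
    AbsEstimate e ψ p q := by
  intro v
  have hle : ∀ i, ‖ψ i v‖ * p (e i) ≤ ‖ψ i v‖ * p' (e i) := fun i =>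
    mul_le_mul_of_nonneg_left (hp _) (norm_nonneg _)
  have hs : Summable fun i => ‖ψ i v‖ * p (e i) :=
    (h v).1.of_nonneg_of_le (fun i => mul_nonneg (norm_nonneg _) (apply_nonneg _ _)) hle
  exact ⟨hs, (hs.tsum_le_tsum hle (h v).1).trans (h v).2⟩

theorem AbsEstimate.mono_right {p q q' : Seminorm 𝕜 E} (h : AbsEstimate e ψ p q) (hq : q ≤ q') :
    AbsEstimate e ψ p q' := fun v => ⟨(h v).1, (h v).2.trans (hq v)⟩

theorem AbsEstimate.zero : AbsEstimate e ψ (0 : Seminorm 𝕜 E) 0 := fun v => by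
  simp [summable_zero]

theorem AbsEstimate.add {p p' q q' : Seminorm 𝕜 E} (h : AbsEstimate e ψ p q)
    (h' : AbsEstimate e ψ p' q') : AbsEstimate e ψ (p + p') (q + q') := by
  intro v
  have heq : (fun i => ‖ψ i v‖ * (p + p') (e i)) =
      fun i => ‖ψ i v‖ * p (e i) + ‖ψ i v‖ * p' (e i) := funext fun i => mul_add _ _ _
  rw [heq, (h v).1.tsum_add (h' v).1]
  exact ⟨(h v).1.add (h' v).1, add_le_add (h v).2 (h' v).2⟩

theorem AbsEstimate.smul {p q : Seminorm 𝕜 E} (h : AbsEstimate e ψ p q) (c : NNReal) :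
    AbsEstimate e ψ (c • p) (c • q) := by
  intro v
  have heq : (fun i => ‖ψ i v‖ * (c • p) (e i)) = fun i => (c : ℝ) * (‖ψ i v‖ * p (e i)) :=
    funext fun i => mul_left_comm _ _ _
  rw [heq, tsum_mul_left]
  exact ⟨(h v).1.mul_left _, mul_le_mul_of_nonneg_left (h v).2 c.2⟩

theorem AbsEstimate.sum {p q : κ → Seminorm 𝕜 E} (h : ∀ k, AbsEstimate e ψ (p k) (q k))
    (s : Finset κ) : AbsEstimate e ψ (∑ k ∈ s, p k) (∑ k ∈ s, q k) := by
  classical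
  induction s using Finset.induction with
  | empty => simpa using AbsEstimate.zero
  | insert a s ha ih =>
    rw [Finset.sum_insert ha, Finset.sum_insert ha]
    exact (h a).add ih

/-- On the algebraic span the expansion is a finite sum, so its partial sums are eventually
constant. -/
theorem exists_finset_sum_smul_eq (h1 : ∀ i, ψ i (e i) = 1) (h0 : ∀ i j, i ≠ j → ψ i (e j) = 0)
    {w : E} (hw : w ∈ Submodule.span 𝕜 (Set.range e)) :
    ∃ A : Finset ι, ∀ F, A ⊆ F → ∑ i ∈ F, ψ i w • e i = w := by
  classical
  induction hw using Submodule.span_induction with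
  | mem x hx =>
    obtain ⟨j, rfl⟩ := hx
    refine ⟨{j}, fun F hF => ?_⟩
    rw [Finset.sum_eq_single j, h1, one_smul]
    · intro i _ hij
      rw [h0 i j hij, zero_smul]
    · exact fun h => (h (hF (Finset.mem_singleton_self j))).elim
  | zero => exact ⟨∅, fun F _ => by simp⟩
  | add x y _ _ hx hy =>
    obtain ⟨A, hA⟩ := hx
    obtain ⟨A', hA'⟩ := hy
    refine ⟨A ∪ A', fun F hF => ?_⟩
    simp only [map_add, add_smul, Finset.sum_add_distrib]
    rw [hA F (Finset.union_subset_left hF), hA' F (Finset.union_subset_right hF)]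
  | smul c x _ hx =>
    obtain ⟨A, hA⟩ := hx
    refine ⟨A, fun F hF => ?_⟩
    simp only [map_smul, smul_assoc, ← Finset.smul_sum]
    rw [hA F hF]

/-- A biorthogonal system with dense span that satisfies absolute estimates for a defining family
of seminorms is an absolute Schauder basis. -/
theorem IsAbsoluteSchauderBasis.of_withSeminorms [Nonempty κ] [TopologicalSpace E]
    {𝔭 : SeminormFamily 𝕜 E κ} (h𝔭 : WithSeminorms 𝔭) (hlin : LinearIndependent 𝕜 e)
    (h1 : ∀ i, ψ i (e i) = 1) (h0 : ∀ i j, i ≠ j → ψ i (e j) = 0)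
    (hbound : ∀ i, ∃ k, ∃ C : ℝ, ∀ v, ‖ψ i v‖ ≤ C * 𝔭 k v)
    (hest : ∀ k, ∃ k', 𝔭 k ≤ 𝔭 k' ∧ AbsEstimate e ψ (𝔭 k) (𝔭 k'))
    (hdense : ∀ k v, v ∈ (𝔭 k).closureSubmodule (Submodule.span 𝕜 (Set.range e))) :
    IsAbsoluteSchauderBasis 𝕜 e ψ where
  linearIndependent := hlin
  continuous_coeff i := by
    obtain ⟨k, C, hC⟩ := hbound i
    refine h𝔭.continuous_of_isBounded (norm_withSeminorms 𝕜 𝕜) (ψ i) fun _ =>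
      ⟨{k}, C.toNNReal, fun v => ?_⟩
    rw [Finset.sup_singleton]
    exact (hC v).trans (mul_le_mul_of_nonneg_right (Real.le_coe_toNNReal C) (apply_nonneg _ _))
  coeff_self := h1
  coeff_of_ne := h0
  expansion v := by
    rw [HasSum, SummationFilter.unconditional_filter, h𝔭.tendsto_nhds]
    intro k ε hε
    obtain ⟨k', hkk', hk'⟩ := hest k
    obtain ⟨w, hw, hvw⟩ := hdense k' v (ε / 2) (half_pos hε)
    obtain ⟨A, hA⟩ := exists_finset_sum_smul_eq h1 h0 hw
    filter_upwards [Filter.eventually_ge_atTop A] with F hF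
    -- Equicontinuity: this bound on the partial sums does not depend on `F`.
    have hT : 𝔭 k (∑ i ∈ F, ψ i (v - w) • e i) ≤ 𝔭 k' (v - w) := by
      refine (Finset.le_sum_of_subadditive (𝔭 k) (map_zero _).le (map_add_le_add _) _ _).trans ?_
      simp only [map_smul_eq_mul]
      exact ((hk' (v - w)).1.sum_le_tsum F fun i _ =>
        mul_nonneg (norm_nonneg _) (apply_nonneg _ _)).trans (hk' (v - w)).2
    have heq : ∑ i ∈ F, ψ i v • e i - v = ∑ i ∈ F, ψ i (v - w) • e i - (v - w) := by
      simp only [map_sub, sub_smul, Finset.sum_sub_distrib]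
      rw [hA F hF]
      abel
    rw [heq]
    linarith [map_sub_le_add (𝔭 k) (∑ i ∈ F, ψ i (v - w) • e i) (v - w), hkk' (v - w)]
  absolute P hP := by
    choose f hf using hest
    -- A continuous seminorm is dominated by finitely many defining ones, whose estimates are added
    -- and scaled.
    obtain ⟨s, C, -, hPC⟩ := Seminorm.bound_of_continuous h𝔭 P hP
    refine ⟨C • ∑ k ∈ s, 𝔭 (f k), ?_, ((AbsEstimate.sum (fun k => (hf k).2) s).smul C).mono_left
      (hPC.trans ?_)⟩
    · have : ⇑(C • ∑ k ∈ s, 𝔭 (f k)) = fun v => (C : ℝ) * ∑ k ∈ s, 𝔭 (f k) v := by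
        funext v
        change (C : ℝ) * (∑ k ∈ s, 𝔭 (f k)) v = _
        rw [← FunLike.coeAddMonoidHom_apply, map_sum, Finset.sum_apply]
        rfl
      rw [this]
      exact continuous_const.mul (continuous_finsetSum _ fun k _ => h𝔭.continuous_seminorm _)
    · intro v
      exact mul_le_mul_of_nonneg_left (Seminorm.finset_sup_le_sum 𝔭 s v) C.2

end Criterion

/-! ### Bases of the symmetric algebra -/

section SymBasis

variable {𝕜 V I : Type*} [RCLike 𝕜] [AddCommGroup V] [Module 𝕜 V]
variable (𝒱 : ZMod 2 → Submodule 𝕜 V) [DirectSum.Decomposition 𝒱]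

theorem WithSeminorms.comp_subtype {E κ : Type*} [AddCommGroup E] [Module 𝕜 E] [Nonempty κ]
    {τ : TopologicalSpace E} {q : SeminormFamily 𝕜 E κ} (hq : WithSeminorms q)
    (N : Submodule 𝕜 E) :
    WithSeminorms (topology := τ.induced N.subtype) fun k => (q k).comp N.subtype :=
  LinearMap.withSeminorms_induced hq N.subtype

theorem WithSeminorms.iInf_of_forall {E ι κ : Type*} [AddCommGroup E] [Module 𝕜 E] [Nonempty κ]
    [Nonempty ι] {τ : ι → TopologicalSpace E} {q : ι → SeminormFamily 𝕜 E κ}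
    (hq : ∀ i, WithSeminorms (topology := τ i) (q i)) :
    WithSeminorms (topology := ⨅ i, τ i) fun k : (_ : ι) × κ => q k.1 k.2 :=
  withSeminorms_iInf hq

theorem withSeminorms_tensorTopology [TopologicalSpace V] (R : ℝ) :
    WithSeminorms (topology := tensorTopology 𝕜 V R)
      (fun p : {p : Seminorm 𝕜 V // Continuous p} => weightedSeminorm p.1 R) :=
  let _ := tensorTopology 𝕜 V R
  ⟨rfl⟩

theorem withSeminorms_symTopology [TopologicalSpace V] (R : ℝ) :
    WithSeminorms (topology := symTopology 𝒱 R)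
      (fun p : {p : Seminorm 𝕜 V // Continuous p} => symSeminorm 𝒱 p.1 R) :=
  WithSeminorms.comp_subtype (E := TensorAlg 𝕜 V)
    (withSeminorms_tensorTopology (𝕜 := 𝕜) (V := V) R) (GradedSym 𝒱)

theorem withSeminorms_weylMinusTopology [TopologicalSpace V] (R : ℝ) :
    WithSeminorms (topology := weylMinusTopology 𝒱 R)
      (fun k : (_ : {ε : ℝ // 0 < ε}) × {p : Seminorm 𝕜 V // Continuous p} =>
        symSeminorm 𝒱 k.2.1 (R - k.1.1)) := by
  have : Nonempty {ε : ℝ // 0 < ε} := ⟨⟨1, one_pos⟩⟩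
  have h := fun ε : {ε : ℝ // 0 < ε} => withSeminorms_symTopology 𝒱 (R - ε.1)
  exact WithSeminorms.iInf_of_forall (E := GradedSym 𝒱)
    (τ := fun ε : {ε : ℝ // 0 < ε} => symTopology 𝒱 (R - ε.1))
    (q := fun ε (p : {p : Seminorm 𝕜 V // Continuous p}) => symSeminorm 𝒱 p.1 (R - ε.1)) h

/-- A maximal linearly independent subset of a set has the same span. -/
theorem LinearIndependent.span_eq_of_forall_insert {E : Type*} [AddCommGroup E] [Module 𝕜 E]
    {s B : Set E} (hB : LinearIndependent 𝕜 fun b : B => (b : E)) (hBs : B ⊆ s)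
    (h : ∀ x ∈ s, LinearIndependent 𝕜 (fun b : ↥(insert x B) => (b : E)) → x ∈ B) :
    Submodule.span 𝕜 B = Submodule.span 𝕜 s :=
  le_antisymm (Submodule.span_mono hBs) <| Submodule.span_le.2 fun x hx => by
    by_contra hxB
    -- A vector outside the span could be added to `B`, so maximality puts it in `B`.
    exact hxB (Submodule.subset_span (h x hx (LinearIndepOn.id_insert hB hxB)))

variable [TopologicalSpace V] [IsTopologicalAddGroup V] {e : I → V} {φ : I → V →ₗ[𝕜] 𝕜}

/-- The coefficient functional of a nonzero symmetrized product does not depend on the order in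
which its factors are written. -/
theorem IsAbsoluteSchauderBasis.rearrangements_smul_symFunctional_eq
    (he : IsAbsoluteSchauderBasis 𝕜 e φ) (h𝒱 : ∀ a, Continuous (parityProj 𝒱 a))
    {ε : I → ZMod 2} (hε : ∀ i, e i ∈ 𝒱 (ε i)) {t s : Σ n : ℕ, Fin n → I}
    (h : symProd 𝒱 (fun k => e (t.2 k)) = symProd 𝒱 fun k => e (s.2 k))
    (h0 : symProd 𝒱 (fun k => e (t.2 k)) ≠ 0) :
    (rearrangements t.2 : 𝕜) • symFunctional 𝒱 (fun k => φ (t.2 k)) =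
      (rearrangements s.2 : 𝕜) • symFunctional 𝒱 fun k => φ (s.2 k) := by
  obtain ⟨σ, rfl⟩ := exists_perm_of_symProd_eq 𝒱 he.coeff_self he.coeff_of_ne hε h h0
  have h1 := symProd_comp_perm 𝒱 σ (v := fun k => e (t.2 k)) fun k => hε (t.2 k)
  have h2 : (koszulSign (fun k => ε (t.2 k)) σ : 𝕜) = 1 :=
    eq_one_of_eq_smul_self (E := GradedSym 𝒱) (h.trans h1) h0
  have h3 := he.symFunctional_comp_perm 𝒱 h𝒱 hε h0 σ
  rw [h2, one_smul] at h3
  simp only [Function.comp_apply]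
  rw [h3, rearrangements_comp]

/-- The absolute estimate passes from the family of all symmetrized products to a linearly
independent set of such products. -/
theorem IsAbsoluteSchauderBasis.absEstimate_of_linearIndepOn (he : IsAbsoluteSchauderBasis 𝕜 e φ)
    (h𝒱 : ∀ a, Continuous (parityProj 𝒱 a)) {ε : I → ZMod 2} (hε : ∀ i, e i ∈ 𝒱 (ε i))
    {B : Set (GradedSym 𝒱)} (hB : LinearIndepOn 𝕜 id B) {t : B → Σ n : ℕ, Fin n → I}
    (ht : ∀ b, symProd 𝒱 (fun k => e ((t b).2 k)) = b) {P Q : Seminorm 𝕜 (GradedSym 𝒱)}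
    (h : AbsEstimate (fun t : Σ n : ℕ, Fin n → I => symProd 𝒱 fun k => e (t.2 k))
      (fun t => symFunctional 𝒱 fun k => φ (t.2 k)) P Q) :
    AbsEstimate (fun b : B => (b : GradedSym 𝒱))
      (fun b => (rearrangements (t b).2 : 𝕜) • symFunctional 𝒱 fun k => φ ((t b).2 k)) P Q := by
  have hlin : LinearIndependent 𝕜 fun b : B => (b : GradedSym 𝒱) := hB
  have hne : ∀ b, symProd 𝒱 (fun k => e ((t b).2 k)) ≠ 0 := fun b => by
    rw [ht]
    exact hlin.ne_zero b
  intro v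
  set f : (Σ n : ℕ, Fin n → I) → ℝ := fun t =>
    ‖symFunctional 𝒱 (fun k => φ (t.2 k)) v‖ * P (symProd 𝒱 fun k => e (t.2 k)) with hf
  have hf0 : ∀ t, 0 ≤ f t := fun t => mul_nonneg (norm_nonneg _) (apply_nonneg _ _)
  -- Reordering changes both factors only by signs, which the norm and `P` ignore.
  have hfperm : ∀ b (σ : Equiv.Perm (Fin (t b).1)), f ⟨(t b).1, (t b).2 ∘ σ⟩ = f (t b) := by
    intro b σ
    have h1 := symProd_comp_perm 𝒱 σ (v := fun k => e ((t b).2 k)) fun k => hε ((t b).2 k)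
    have h2 := he.symFunctional_comp_perm 𝒱 h𝒱 hε (hne b) σ
    change ‖symFunctional 𝒱 (fun k => φ ((t b).2 (σ k))) v‖ *
      P (symProd 𝒱 ((fun k => e ((t b).2 k)) ∘ σ)) = _
    rw [h1, h2, LinearMap.smul_apply, norm_smul, map_smul_eq_mul, norm_koszulSign, one_mul, one_mul]
  let O : B → Type _ := fun b =>
    {s : Fin (t b).1 → I // ∃ σ : Equiv.Perm (Fin (t b).1), s = (t b).2 ∘ σ}
  let g : (Σ b, O b) → Σ n : ℕ, Fin n → I := fun x => ⟨(t x.1).1, x.2.1⟩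
  -- If two elements of `B` shared a rearrangement they would agree up to sign, contrary to
  -- independence unless they are equal.
  have hg : Function.Injective g := by
    rintro ⟨b, s, σ, rfl⟩ ⟨b', s', σ', rfl⟩ hbb
    have h1 : (koszulSign (fun k => ε ((t b).2 k)) σ : 𝕜) • (b : GradedSym 𝒱) =
        (koszulSign (fun k => ε ((t b').2 k)) σ' : 𝕜) • (b' : GradedSym 𝒱) := by
      rw [← ht b, ← ht b', ← symProd_comp_perm 𝒱 σ (v := fun k => e ((t b).2 k)) fun k => hε _,
        ← symProd_comp_perm 𝒱 σ' (v := fun k => e ((t b').2 k)) fun k => hε _]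
      exact congrArg (fun t : Σ n : ℕ, Fin n → I => symProd 𝒱 fun k => e (t.2 k)) hbb
    obtain rfl := hlin.eq_of_smul_apply_eq_smul_apply _ _ _ _
      (norm_ne_zero_iff.1 (by rw [norm_koszulSign]; exact one_ne_zero)) h1
    have h2 := eq_of_heq (Sigma.mk.inj hbb).2
    simp only at h2
    simp only [h2]
  have hfg : Summable (f ∘ g) := (h v).1.comp_injective hg
  -- The summand is constant on the orbit, whose size is exactly the factor `rearrangements (t
  -- b).2`.
  have hfib : ∀ b, ∑' s : O b, (f ∘ g) ⟨b, s⟩ =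
      ‖((rearrangements (t b).2 : 𝕜) • symFunctional 𝒱 fun k => φ ((t b).2 k)) v‖ *
        P (b : GradedSym 𝒱) := by
    intro b
    have h1 : ∀ s : O b, (f ∘ g) ⟨b, s⟩ = f (t b) := by
      rintro ⟨_, σ, rfl⟩
      exact hfperm b σ
    rw [tsum_congr h1, tsum_const, LinearMap.smul_apply, norm_smul, RCLike.norm_natCast, mul_assoc,
      nsmul_eq_mul]
    simp only [hf]
    rw [ht]
    rfl
  constructor
  · simpa only [hfib] using hfg.sigma
  · rw [← tsum_congr hfib, ← hfg.tsum_sigma]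
    exact (Summable.tsum_le_tsum_of_inj g hg (fun c _ => hf0 c) (fun _ => le_rfl) hfg
      (h v).1).trans (h v).2

end SymBasis

/-! ### The proposition -/

theorem mainTheorem4 {𝕜 V I : Type*} [RCLike 𝕜] [AddCommGroup V] [Module 𝕜 V]
    [TopologicalSpace V] [IsTopologicalAddGroup V] [ContinuousSMul 𝕜 V] [T2Space V]
    [PolynormableSpace 𝕜 V]
    (𝒱 : ZMod 2 → Submodule 𝕜 V) [DirectSum.Decomposition 𝒱]
    (h𝒱 : ∀ a : ZMod 2, Continuous (parityProj 𝒱 a))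
    (R : ℝ) (hR : 0 ≤ R)
    (e : I → V) (φ : I → V →ₗ[𝕜] 𝕜)
    (he : IsAbsoluteSchauderBasis 𝕜 e φ)
    (hhom : ∀ i, SetLike.IsHomogeneousElem 𝒱 (e i)) :
    -- every maximal linearly independent subset of the symmetrized products is a basis
    (∀ B : Set (GradedSym 𝒱),
      Maximal (fun C : Set (GradedSym 𝒱) =>
        C ⊆ Set.range (fun t : Σ n : ℕ, Fin n → I => symProd 𝒱 (fun k => e (t.2 k))) ∧
          LinearIndepOn 𝕜 id C) B →
      ∃ ψ : B → GradedSym 𝒱 →ₗ[𝕜] 𝕜,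
        -- the coefficient functionals are the corresponding symmetrized functionals
        (∀ (b : B) (n : ℕ) (t : Fin n → I), (b : GradedSym 𝒱) = symProd 𝒱 (fun k => e (t k)) →
          ψ b = (rearrangements t : 𝕜) • symFunctional 𝒱 (fun k => φ (t k))) ∧
        IsAbsoluteSchauderBasis 𝕜 (τ := symTopology 𝒱 R) (fun b : B => (b : GradedSym 𝒱)) ψ ∧
        IsAbsoluteSchauderBasis 𝕜 (τ := weylMinusTopology 𝒱 R) (fun b : B => (b : GradedSym 𝒱)) ψ ∧
        ∀ p q : Seminorm 𝕜 V, Continuous p → Continuous q → AbsEstimate e φ p q →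
          ∀ S ≤ R, AbsEstimate (fun b : B => (b : GradedSym 𝒱)) ψ
            (symSeminorm 𝒱 p S) (symSeminorm 𝒱 q S)) ∧
    -- the estimate for the sum over all tuples of indices
    (∀ p q : Seminorm 𝕜 V, Continuous p → Continuous q → AbsEstimate e φ p q →
      ∀ S ≤ R, AbsEstimate
        (fun t : Σ n : ℕ, Fin n → I => symProd 𝒱 (fun k => e (t.2 k)))
        (fun t => symFunctional 𝒱 (fun k => φ (t.2 k)))
        (symSeminorm 𝒱 p S) (symSeminorm 𝒱 q S)) := by
  refine ⟨fun B hB => ?_, fun p q _ _ h S _ => h.gradedSym 𝒱 hhom S⟩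
  choose ε hε using hhom
  have hlin : LinearIndependent 𝕜 fun b : B => (b : GradedSym 𝒱) := hB.prop.2
  -- One spelling of each `b` is fixed; `rearrangements_smul_symFunctional_eq` later shows that the
  -- choice is immaterial.
  choose t ht using fun b : B => hB.prop.1 b.2
  simp only at ht
  have hne : ∀ b, symProd 𝒱 (fun k => e ((t b).2 k)) ≠ 0 := fun b => by
    rw [ht]
    exact hlin.ne_zero b
  set ψ : B → GradedSym 𝒱 →ₗ[𝕜] 𝕜 := fun b =>
    (rearrangements (t b).2 : 𝕜) • symFunctional 𝒱 fun k => φ ((t b).2 k) with hψ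
  have hest : ∀ p q : Seminorm 𝕜 V, AbsEstimate e φ p q → ∀ S : ℝ,
      AbsEstimate (fun b : B => (b : GradedSym 𝒱)) ψ (symSeminorm 𝒱 p S) (symSeminorm 𝒱 q S) :=
    fun p q h S => he.absEstimate_of_linearIndepOn 𝒱 h𝒱 hε hB.prop.2 ht
      (h.gradedSym 𝒱 (fun i => ⟨ε i, hε i⟩) S)
  have h1 : ∀ b, ψ b b = 1 := fun b => by
    simp only [hψ]
    rw [LinearMap.smul_apply, smul_eq_mul]
    conv_lhs => rw [← ht b]
    exact rearrangements_mul_symFunctional_symProd 𝒱 he.coeff_self he.coeff_of_ne hε (hne b)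
  have h0 : ∀ b b', b ≠ b' → ψ b b' = 0 := by
    intro b b' hbb
    simp only [hψ]
    rw [LinearMap.smul_apply]
    refine smul_eq_zero_of_right _ ?_
    -- A nonzero pairing would make `b` a rearrangement of `b'`, hence equal to it up to sign.
    by_contra h2
    rw [← ht b'] at h2
    obtain ⟨σ, hσ⟩ := exists_perm_of_symFunctional_symProd_ne_zero 𝒱 he.coeff_of_ne hε h2
    have h3 := symProd_comp_perm 𝒱 σ (v := fun k => e ((t b').2 k)) fun k => hε ((t b').2 k)
    have h4 := congrArg (fun t : Σ n : ℕ, Fin n → I => symProd 𝒱 fun k => e (t.2 k)) hσ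
    refine hbb (hlin.eq_of_smul_apply_eq_smul_apply 1
      (koszulSign (fun k => ε ((t b').2 k)) σ : 𝕜) _ _ one_ne_zero ?_)
    rw [one_smul, ← ht b, ← ht b', ← h3]
    exact h4
  have hmax : ∀ x ∈ Set.range fun t : Σ n : ℕ, Fin n → I => symProd 𝒱 fun k => e (t.2 k),
      LinearIndependent 𝕜 (fun b : ↥(insert x B) => (b : GradedSym 𝒱)) → x ∈ B := fun x hx h =>
    hB.le_of_ge ⟨Set.insert_subset hx hB.prop.1, h⟩ (Set.subset_insert x B) (Set.mem_insert x B)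
  have hspan : Submodule.span 𝕜 B = Submodule.span 𝕜
      (Set.range fun t : Σ n : ℕ, Fin n → I => symProd 𝒱 fun k => e (t.2 k)) :=
    LinearIndependent.span_eq_of_forall_insert (E := GradedSym 𝒱) (B := B) hlin hB.prop.1 hmax
  have hdense : ∀ (p : Seminorm 𝕜 V), Continuous p → ∀ (S : ℝ) (v : GradedSym 𝒱),
      v ∈ (symSeminorm 𝒱 p S).closureSubmodule
        (Submodule.span 𝕜 (Set.range fun b : B => (b : GradedSym 𝒱))) := by
    intro p hp S v
    rw [Subtype.range_coe, hspan]
    exact he.mem_closureSubmodule_symProd 𝒱 h𝒱 hp S v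
  have hbound : ∀ b, ∃ q : Seminorm 𝕜 V, Continuous q ∧ ∀ S : ℝ, ∃ C : ℝ, ∀ v,
      ‖ψ b v‖ ≤ C * symSeminorm 𝒱 q S v := by
    intro b
    obtain ⟨q, hq, hqt⟩ := he.exists_seminorm_coeff (t b).2
    refine ⟨q, hq, fun S => ⟨(rearrangements (t b).2 : ℝ) * (((t b).1.factorial : ℝ) ^ S)⁻¹,
      fun v => ?_⟩⟩
    simp only [hψ]
    rw [LinearMap.smul_apply, norm_smul, RCLike.norm_natCast, mul_assoc]
    exact mul_le_mul_of_nonneg_left (norm_symFunctional_le 𝒱 hqt S v) (Nat.cast_nonneg _)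
  have hbig : ∀ p : Seminorm 𝕜 V, Continuous p →
      ∃ q : Seminorm 𝕜 V, Continuous q ∧ p ≤ q ∧ AbsEstimate e φ p q := by
    intro p hp
    obtain ⟨q, hq, hpq⟩ := he.absolute p hp
    -- Passing from `q` to `p + q` secures domination of `p`, which the criterion demands.
    exact ⟨p + q, hp.add hq, le_add_of_nonneg_right fun v => apply_nonneg q v,
      hpq.mono_right (le_add_of_nonneg_left fun v => apply_nonneg p v)⟩
  refine ⟨ψ, fun b n s hs => ?_, ?_, ?_, fun p q _ _ h S _ => hest p q h S⟩
  · exact he.rearrangements_smul_symFunctional_eq 𝒱 h𝒱 hε (s := ⟨n, s⟩) ((ht b).trans hs) (hne b)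
  · let _ : TopologicalSpace (GradedSym 𝒱) := symTopology 𝒱 R
    refine IsAbsoluteSchauderBasis.of_withSeminorms (E := GradedSym 𝒱)
      (withSeminorms_symTopology 𝒱 R) hlin h1 h0
      (fun b => ?_) (fun k => ?_) fun k => hdense k.1 k.2 R
    · obtain ⟨q, hq, hC⟩ := hbound b
      exact ⟨⟨q, hq⟩, hC R⟩
    · obtain ⟨q, hq, hpq, h⟩ := hbig k.1 k.2
      exact ⟨⟨q, hq⟩, symSeminorm_mono 𝒱 hpq R, hest _ _ h R⟩
  · let _ : TopologicalSpace (GradedSym 𝒱) := weylMinusTopology 𝒱 R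
    have : Nonempty ((_ : {ε : ℝ // 0 < ε}) × {p : Seminorm 𝕜 V // Continuous p}) :=
      ⟨⟨⟨1, one_pos⟩, ⟨0, continuous_const⟩⟩⟩
    refine IsAbsoluteSchauderBasis.of_withSeminorms (E := GradedSym 𝒱)
      (withSeminorms_weylMinusTopology 𝒱 R) hlin h1 h0
      (fun b => ?_) (fun k => ?_) fun k => hdense k.2.1 k.2.2 _
    · obtain ⟨q, hq, hC⟩ := hbound b
      -- The functional is bounded for every exponent, so any `ε` serves; `1` is an arbitrary
      -- choice.
      exact ⟨⟨⟨1, one_pos⟩, ⟨q, hq⟩⟩, hC _⟩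
    · obtain ⟨q, hq, hpq, h⟩ := hbig k.2.1 k.2.2
      -- The estimate does not lower the exponent, so `ε` is kept.
      exact ⟨⟨k.1, ⟨q, hq⟩⟩, symSeminorm_mono 𝒱 hpq _, hest _ _ h _⟩

end
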